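/- For integers $m,n\ge 1$ let $BS(m,n)=\langle a,t\mid ta^mt^{-1}=a^n\rangle$ and $k=\gcd(m,n)$. Let $Z_{m,n}$ be the $2$-complex with one vertex, $1$-cells $a,t_0,\dots,t_{k-1}$ (with $t_0=t$), and $k$ two-cells attached along the words $t_i\,a^{m/k}\,t_{i+1}^{-1}\,a^{-n/k}$ ($i$ modulo $k$); it is a subdivision of the presentation $2$-complex of $BS(m,n)$. Let $X_{m,n}$ be the universal cover of $Z_{m,n}$ with the induced cell structure. Let $\mathrm{Aut}(X_{m,n})$ be the group of self-homeomorphisms of $X_{m,n}$ preserving the cell structure, modulo those inducing the identity permutation of the set of cells, with the topology having as subbasis the sets $\{f\mid f(\sigma)=\tau\}$ for all pairs of cells $\sigma,\tau$. The branching lines of $X_{m,n}$ are the lines made of lifts of the $1$-cell $a$, all oriented in the direction of $a$; an automorphism is called orientation preserving (respectively, reversing) if it maps every branching line onto a branching line preserving (respectively, reversing) the orientation. Theorem. For all $m,n\ge 1$ the group $\mathrm{Aut}(X_{m,n})$ is discrete if and only if $\gcd(m,n)=1$. If $\gcd(m,n)=1$ and $(m,n)\ne(1,1)$, then every automorphism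 is either orientation preserving or orientation reversing, and there is a short exact sequence of groups $$1\to BS(m,n)\to \mathrm{Aut}(X_{m,n})\xrightarrow{\ \chi\ }\{\pm1\}\to 1,$$ where the first map is the action of $BS(m,n)=\pi_1(Z_{m,n})$ by deck transformations, and $\chi$ is the orientation character: $\chi(f)=1$ if $f$ is orientation preserving and $\chi(f)=-1$ if $f$ is orientation reversing. -/

import Mathlib

/-! ### Automorphisms of spaces with a cell structure

A cell structure on a space `X` is recorded by the family of its open cells: `C d` is the set of all
open `d`-cells, each of them a subset of `X`. -/

namespace CellStructure

variable {X : Type*} [TopologicalSpace X] (C : ℕ → Set (Set X))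

/-- The group of topological automorphisms: the self-homeomorphisms of `X` that preserve the
cell structure, that is, permute the open `d`-cells for every `d`. -/
def AutTop : Subgroup (X ≃ₜ X) where
  carrier := {f | ∀ d s, f '' s ∈ C d ↔ s ∈ C d}
  one_mem' := by
    intro d s
    have h : ((1 : X ≃ₜ X) : X → X) '' s = s := Set.image_id s
    rw [h]
  mul_mem' := by
    intro f g hf hg d s
    have h : ((f * g : X ≃ₜ X) : X → X) '' s = f '' (g '' s) := Set.image_comp f g s
    rw [h, hf, hg]
  inv_mem' := by
    intro f hf d s
    have h : f '' ((f⁻¹ : X ≃ₜ X) '' s) = s := f.image_symm_image s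
    rw [← hf, h]

/-- The type of all open cells (of all dimensions). -/
def Cells : Type _ := {s : Set X // ∃ d, s ∈ C d}

/-- The permutation of the set of cells induced by a topological automorphism. -/
def permHom : AutTop C →* Equiv.Perm (Cells C) where
  toFun f :=
    { toFun := fun s => ⟨f.1 '' s.1, s.2.imp fun d h => (f.2 d s.1).2 h⟩
      invFun := fun s => ⟨(f⁻¹).1 '' s.1, s.2.imp fun d h => ((f⁻¹).2 d s.1).2 h⟩
      left_inv := fun s => Subtype.ext (f.1.symm_image_image s.1)
      right_inv := fun s => Subtype.ext (f.1.image_symm_image s.1) }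
  map_one' := Equiv.ext fun s => Subtype.ext (Set.image_id s.1)
  map_mul' f g := Equiv.ext fun s => Subtype.ext (Set.image_comp f.1 g.1 s.1)

/-- The combinatorial automorphism group: the quotient of the group of topological automorphisms in
which two of them are identified if they induce the same permutation of the set of cells. -/
def Aut : Type _ := AutTop C ⧸ (permHom C).ker

instance : Group (Aut C) := inferInstanceAs (Group (AutTop C ⧸ (permHom C).ker))

/-- The (faithful) action of the combinatorial automorphism group on the set of cells. -/
def cellPerm : Aut C →* Equiv.Perm (Cells C) := QuotientGroup.kerLift (permHom C)

/-- The topology on the combinatorial automorphism group, with subbasis the sets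
`{f | f σ = τ}`, for all pairs of cells `σ`, `τ`. -/
instance : TopologicalSpace (Aut C) :=
  TopologicalSpace.generateFrom
    {U | ∃ σ τ : Cells C, U = {f : Aut C | cellPerm C f σ = τ}}

end CellStructure

/-! ### Baumslag–Solitar groups and their complexes -/

namespace BaumslagSolitar

open CellStructure

/-- The two generators of `BS(m,n)`. -/
inductive BSGen
  | a
  | t

/-- The Baumslag–Solitar group `BS(m,n) = ⟨a, t ∣ t a^m t⁻¹ = a^n⟩`. -/
abbrev BS (m n : ℕ) : Type :=
  PresentedGroup
    ({FreeGroup.of BSGen.t * FreeGroup.of BSGen.a ^ m * (FreeGroup.of BSGen.t)⁻¹ *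
      (FreeGroup.of BSGen.a ^ n)⁻¹} : Set (FreeGroup BSGen))

/-- The `1`-cells of the one-vertex complex `Z_{m,n}`, where `k = gcd(m,n)`: a loop `a` and loops
`t i`, with `i` modulo `k` (`t 0` is the stable letter `t`). -/
inductive Gen (k : ℕ)
  | a
  | t (i : ZMod k)

variable (m n : ℕ)

/-- The boundary words `t_i a^{m/k} t_{i+1}⁻¹ a^{-n/k}` (`i` modulo `k = gcd(m,n)`) of the `k`
`2`-cells of `Z_{m,n}`. -/
def boundaryWord (i : ZMod (m.gcd n)) : FreeGroup (Gen (m.gcd n)) :=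
  FreeGroup.of (Gen.t i) * FreeGroup.of Gen.a ^ (m / m.gcd n) *
    (FreeGroup.of (Gen.t (i + 1)))⁻¹ * (FreeGroup.of Gen.a ^ (n / m.gcd n))⁻¹

/-- The fundamental group of `Z_{m,n}`: since `Z_{m,n}` has just one vertex, it is presented by the
`1`-cells as generators and the boundary words of the `2`-cells as relators. -/
abbrev PiOne : Type := PresentedGroup (Set.range (boundaryWord m n))

/-- The element of the fundamental group represented by a `1`-cell of `Z_{m,n}`. -/
def gen (x : Gen (m.gcd n)) : PiOne m n := PresentedGroup.of x

/-- Indices for the cells of the universal cover `X_{m,n}` of `Z_{m,n}`: the fundamental group acts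
simply transitively on the lifts of each cell of `Z_{m,n}`, so these are indexed by the group. The
vertex `g` is the translate by `g` of the base vertex, the edge `(g, x)` is the lift of the loop
`x` that starts at the vertex `g` (and ends at `g * x`), and the face `(g, i)` is the lift of the
`i`-th `2`-cell whose boundary word is read off from the vertex `g`. -/
inductive CellIndex
  | vertex (g : PiOne m n)
  | edge (g : PiOne m n) (x : Gen (m.gcd n))
  | face (g : PiOne m n) (i : ZMod (m.gcd n))

variable {m n}

/-- The dimension of a cell. -/
def CellIndex.dim : CellIndex m n → ℕ
  | .vertex _ => 0
  | .edge _ _ => 1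
  | .face _ _ => 2

/-- The closed cell that is to be attached: a point, an interval, or a square. -/
def CellIndex.Model : CellIndex m n → Type
  | .vertex _ => Unit
  | .edge _ _ => unitInterval
  | .face _ _ => unitInterval × unitInterval

instance (c : CellIndex m n) : TopologicalSpace c.Model :=
  match c with
  | .vertex _ => inferInstanceAs (TopologicalSpace Unit)
  | .edge _ _ => inferInstanceAs (TopologicalSpace unitInterval)
  | .face _ _ => inferInstanceAs (TopologicalSpace (unitInterval × unitInterval))

/-- The interior of the closed cell. -/
def CellIndex.interior : (c : CellIndex m n) → Set c.Model
  | .vertex _ => (Set.univ : Set Unit)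
  | .edge _ _ => (Set.Ioo 0 1 : Set unitInterval)
  | .face _ _ => (Set.Ioo 0 1 ×ˢ Set.Ioo 0 1 : Set (unitInterval × unitInterval))

variable (m n)

/-- The disjoint union of all the closed cells. -/
abbrev DisjointCells : Type := Σ c : CellIndex m n, c.Model

variable {m n}

/-- The point of a vertex, as a point of the disjoint union. -/
def ptV (g : PiOne m n) : DisjointCells m n := ⟨.vertex g, ()⟩

/-- The point with parameter `u` of a closed edge, as a point of the disjoint union. -/
def ptE (g : PiOne m n) (x : Gen (m.gcd n)) (u : unitInterval) : DisjointCells m n :=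
  ⟨.edge g x, u⟩

/-- The point with coordinates `(x, y)` of a closed face, as a point of the disjoint union. -/
def ptF (g : PiOne m n) (i : ZMod (m.gcd n)) (x y : unitInterval) : DisjointCells m n :=
  ⟨.face g i, (x, y)⟩

variable (m n)

/-- The attaching maps. An edge `(g, x)` runs from the vertex `g` to the vertex `g * x`. The square
`(g, i)` has its left side attached to the edge `t_i` at `g`, its right side to the edge `t_{i+1}`
at `g * a^{n/k}`, its lower side to the path of the `n/k` edges `a` that starts at `g`, and its
upper side to the path of the `m/k` edges `a` that starts at `g * t_i`. -/
inductive Glue : DisjointCells m n → DisjointCells m n → Prop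
  | source (g : PiOne m n) (x : Gen (m.gcd n)) : Glue (ptE g x 0) (ptV g)
  | target (g : PiOne m n) (x : Gen (m.gcd n)) : Glue (ptE g x 1) (ptV (g * gen m n x))
  | left (g : PiOne m n) (i : ZMod (m.gcd n)) (y : unitInterval) :
      Glue (ptF g i 0 y) (ptE g (.t i) y)
  | right (g : PiOne m n) (i : ZMod (m.gcd n)) (y : unitInterval) :
      Glue (ptF g i 1 y) (ptE (g * gen m n .a ^ (n / m.gcd n)) (.t (i + 1)) y)
  | lower (g : PiOne m n) (i : ZMod (m.gcd n)) (x u : unitInterval) (j : ℕ)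
      (hj : j < n / m.gcd n) (hx : (x : ℝ) * ((n / m.gcd n : ℕ) : ℝ) = j + u) :
      Glue (ptF g i x 0) (ptE (g * gen m n .a ^ j) .a u)
  | upper (g : PiOne m n) (i : ZMod (m.gcd n)) (x u : unitInterval) (j : ℕ)
      (hj : j < m / m.gcd n) (hx : (x : ℝ) * ((m / m.gcd n : ℕ) : ℝ) = j + u) :
      Glue (ptF g i x 1) (ptE (g * gen m n (.t i) * gen m n .a ^ j) .a u)

/-- The `2`-complex `X_{m,n}`, the universal cover of `Z_{m,n}` with the induced cell structure: the
closed cells glued along the attaching maps, with the quotient topology. -/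
def X : Type := Quot (Glue m n)

instance : TopologicalSpace (X m n) := inferInstanceAs (TopologicalSpace (Quot (Glue m n)))

variable {m n}

/-- The open cell of `X_{m,n}` with a given index: the image of the interior of the closed cell. -/
def openCell (c : CellIndex m n) : Set (X m n) :=
  (fun p : c.Model => (Quot.mk (Glue m n) ⟨c, p⟩ : X m n)) '' c.interior

variable (m n)

/-- The cell structure of `X_{m,n}`: the set of its open `d`-cells, for each `d`. -/
def openCells (d : ℕ) : Set (Set (X m n)) := {s | ∃ c : CellIndex m n, c.dim = d ∧ openCell c = s}

/-- The combinatorial automorphism group `Aut(X_{m,n})`. -/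
abbrev AutX : Type := Aut (openCells m n)

variable {m n}

/-- The vertex `g` of `X_{m,n}`, as a `0`-cell. -/
def vertexCell (g : PiOne m n) : Cells (openCells m n) :=
  ⟨openCell (.vertex g), 0, .vertex g, rfl, rfl⟩

/-- The branching lines of `X_{m,n}` are the lines of horizontal edges `a`, with successive vertices
`…, g a⁻¹, g, g a, g a², …`; the direction of `a` orients them all consistently. An automorphism
is orientation preserving if it maps every branching line onto a branching line with
preservation of the orientation. -/
def OrientationPreserving (f : AutX m n) : Prop :=
  ∀ g : PiOne m n, ∃ h : PiOne m n, ∀ j : ℤ,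
    cellPerm _ f (vertexCell (g * gen m n .a ^ j)) = vertexCell (h * gen m n .a ^ j)

/-- An automorphism is orientation reversing if it maps every branching line onto a branching line
with reversal of the orientation. -/
def OrientationReversing (f : AutX m n) : Prop :=
  ∀ g : PiOne m n, ∃ h : PiOne m n, ∀ j : ℤ,
    cellPerm _ f (vertexCell (g * gen m n .a ^ j)) = vertexCell (h * gen m n .a ^ (-j))

end BaumslagSolitar

/-!
Let `G` be the fundamental group of `Z_{m,n}` and let `k = gcd(m,n)`. The lifts of
each cell of `Z_{m,n}` to `X_{m,n}` are indexed by `G`.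

*From topology to combinatorics.* The function `cellOf` maps a point to the index of its open
cell, so that the open cells partition the space, and a union of open cells which contains the
boundary of each of them is closed (`isClosed_subcomplex`). Hence the relation `Incident`, "the
closed cell `c` meets the open cell `d`", is visible in the topology (`incident_iff`), and
`Aut(X_{m,n})` acts faithfully on the indices, with preservation of dimension and incidence
(`isCellAut_indexPerm`).

*The case `k ≠ 1`.* A permutation of the vertices which commutes with right multiplication by `a`,
and which turns the edges `t_i` at `g` into edges `t_{i + s(g)}`, with `s` constant on branching
lines, extends to an automorphism (`Relabelling.exists_aut`). If `s(g) = c(height g)` for some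
function `c`, where the height is the exponent sum of the `t_i`, then such a permutation exists,
as the rule defines a right action of `G` (`twist`). Let `c` be `1` at a height `N` and `0`
elsewhere. The automorphism is not trivial, because `t_0 ≠ t_1` (`t_zero_ne_t_one`), but it fixes
any given cell if `N` is large. So the trivial group is not open (`not_discreteTopology`).

*The case `k = 1`, `(m,n) ≠ (1,1)`.* An edge `a` lies in `m + n ≥ 3` faces, an edge `t` in only
two, so that an automorphism preserves the two kinds of edges. As it is injective on the vertices
and `a` has infinite order, it maps branching lines to branching lines. It preserves the direction
of the edges `t`, since otherwise it would exchange the two horizontal sides of a face, which have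
lengths `m ≠ n`. The relation `t a^m = a^n t` then shows that the effect on the orientation is the
same for all branching lines (`IsCellAut.exists_orientation`). An automorphism which preserves the
orientation commutes with right multiplication by the generators on the vertices, so it is a left
translation (`exists_deck_eq`), and the automorphism `a ↦ a⁻¹`, `t ↦ t` of `G` gives one which
reverses it (`exists_reflection`). No normal form theorem for `G` is needed: it is enough to know
the height, and that `a` has infinite order (`a_zpow_injective`), which is seen in the affine
action on `ℚ`.

*Discreteness for `k = 1`.* By the above, and by a separate argument on the square grid for
`m = n = 1` (`IsCellAut.vertexMap_eq_self_of_grid`), an automorphism that fixes the vertices `1`, `a` and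
`t` is trivial.
-/

namespace BaumslagSolitar

open CellStructure

variable {m n : ℕ}

/-! ### The decomposition into open cells -/

/-- The index of the open cell that contains the point with parameter `u` of the edge `(g, x)`. -/
noncomputable def edgeCell (g : PiOne m n) (x : Gen (m.gcd n)) (u : unitInterval) :
    CellIndex m n :=
  open Classical in
  if u = 0 then .vertex g else if u = 1 then .vertex (g * gen m n x) else .edge g x

/-- The index of the open cell that contains the point at distance `r` from the vertex `g`, in the
direction of `a`, on the branching line through `g`. -/
noncomputable def lineCell (g : PiOne m n) (r : ℝ) : CellIndex m n :=
  open Classical in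
  if Int.fract r = 0 then .vertex (g * gen m n .a ^ ⌊r⌋) else .edge (g * gen m n .a ^ ⌊r⌋) .a

/-- The index of the open cell that contains the point with coordinates `(x, y)` of the face
`(g, i)`. -/
noncomputable def faceCell (g : PiOne m n) (i : ZMod (m.gcd n)) (x y : unitInterval) :
    CellIndex m n :=
  open Classical in
  if x = 0 then edgeCell g (.t i) y
  else if x = 1 then edgeCell (g * gen m n .a ^ (n / m.gcd n)) (.t (i + 1)) y
  else if y = 0 then lineCell g ((x : ℝ) * ((n / m.gcd n : ℕ) : ℝ))
  else if y = 1 then lineCell (g * gen m n (.t i)) ((x : ℝ) * ((m / m.gcd n : ℕ) : ℝ))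
  else .face g i

@[simp] lemma edgeCell_zero (g : PiOne m n) (x : Gen (m.gcd n)) :
    edgeCell g x 0 = .vertex g := by simp [edgeCell]

@[simp] lemma edgeCell_one (g : PiOne m n) (x : Gen (m.gcd n)) :
    edgeCell g x 1 = .vertex (g * gen m n x) := by simp [edgeCell]

lemma edgeCell_of_ne (g : PiOne m n) (x : Gen (m.gcd n)) {u : unitInterval} (h0 : u ≠ 0)
    (h1 : u ≠ 1) : edgeCell g x u = .edge g x := by simp [edgeCell, h0, h1]

lemma lineCell_natCast (g : PiOne m n) (j : ℕ) :
    lineCell g (j : ℝ) = .vertex (g * gen m n .a ^ j) := by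
  simp [lineCell]

lemma lineCell_add (g : PiOne m n) (j : ℕ) (u : unitInterval) :
    lineCell g (j + u) = edgeCell (g * gen m n .a ^ j) .a u := by
  by_cases h0 : u = 0
  · subst h0; simp [lineCell]
  by_cases h1 : u = 1
  · subst h1
    have : (j : ℝ) + ((1 : unitInterval) : ℝ) = ((j + 1 : ℕ) : ℝ) := by simp
    rw [this, lineCell_natCast, edgeCell_one, pow_succ, mul_assoc]
  have h2 : (u : ℝ) < 1 := lt_of_le_of_ne u.2.2 fun h => h1 (Subtype.ext h)
  have h3 : (u : ℝ) ≠ 0 := fun h => h0 (Subtype.ext h)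
  have h4 : Int.fract (u : ℝ) = u := Int.fract_eq_self.2 ⟨u.2.1, h2⟩
  have h5 : ⌊(u : ℝ)⌋ = 0 := Int.floor_eq_zero_iff.2 ⟨u.2.1, h2⟩
  rw [edgeCell_of_ne _ _ h0 h1, lineCell, Int.fract_natCast_add, Int.floor_natCast_add, h4, h5]
  simp [h3]

/-- The defining relation of the fundamental group. -/
lemma gen_relation (i : ZMod (m.gcd n)) :
    gen m n (.t i) * gen m n .a ^ (m / m.gcd n) =
      gen m n .a ^ (n / m.gcd n) * gen m n (.t (i + 1)) := by
  have h : PresentedGroup.mk (Set.range (boundaryWord m n)) (boundaryWord m n i) = 1 :=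
    PresentedGroup.one_of_mem ⟨i, rfl⟩
  simp only [boundaryWord, map_mul, map_pow, map_inv] at h
  rw [mul_inv_eq_one, mul_inv_eq_iff_eq_mul] at h
  exact h

lemma faceCell_zero_left (g : PiOne m n) (i : ZMod (m.gcd n)) (y : unitInterval) :
    faceCell g i 0 y = edgeCell g (.t i) y := by simp [faceCell]

lemma faceCell_one_left (g : PiOne m n) (i : ZMod (m.gcd n)) (y : unitInterval) :
    faceCell g i 1 y = edgeCell (g * gen m n .a ^ (n / m.gcd n)) (.t (i + 1)) y := by
  simp [faceCell]

lemma faceCell_zero_right (g : PiOne m n) (i : ZMod (m.gcd n)) (x : unitInterval) :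
    faceCell g i x 0 = lineCell g ((x : ℝ) * ((n / m.gcd n : ℕ) : ℝ)) := by
  by_cases h0 : x = 0
  · subst h0; simp [faceCell, lineCell]
  by_cases h1 : x = 1
  · subst h1; rw [faceCell_one_left, edgeCell_zero, Set.Icc.coe_one, one_mul, lineCell_natCast]
  simp [faceCell, h0, h1]

lemma faceCell_one_right (g : PiOne m n) (i : ZMod (m.gcd n)) (x : unitInterval) :
    faceCell g i x 1 =
      lineCell (g * gen m n (.t i)) ((x : ℝ) * ((m / m.gcd n : ℕ) : ℝ)) := by
  by_cases h0 : x = 0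
  · subst h0; simp [faceCell, lineCell]
  by_cases h1 : x = 1
  · subst h1
    rw [faceCell_one_left, edgeCell_one, Set.Icc.coe_one, one_mul, lineCell_natCast,
      mul_assoc, mul_assoc, gen_relation]
  simp [faceCell, h0, h1]

lemma faceCell_of_ne (g : PiOne m n) (i : ZMod (m.gcd n)) {x y : unitInterval} (h0 : x ≠ 0)
    (h1 : x ≠ 1) (h2 : y ≠ 0) (h3 : y ≠ 1) : faceCell g i x y = .face g i := by
  simp [faceCell, h0, h1, h2, h3]

/-- The index of the open cell that contains the image of a point of the disjoint union. -/
noncomputable def preCell : DisjointCells m n → CellIndex m n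
  | ⟨.vertex g, _⟩ => .vertex g
  | ⟨.edge g x, u⟩ => edgeCell g x u
  | ⟨.face g i, w⟩ => faceCell g i (w : unitInterval × unitInterval).1
      (w : unitInterval × unitInterval).2

lemma preCell_eq_of_glue {p q : DisjointCells m n} (h : Glue m n p q) : preCell p = preCell q := by
  induction h with
  | source g x => exact edgeCell_zero g x
  | target g x => exact edgeCell_one g x
  | left g i y => exact faceCell_zero_left g i y
  | right g i y => exact faceCell_one_left g i y
  | lower g i x u j hj hx =>
    change faceCell g i x 0 = edgeCell _ _ u
    rw [faceCell_zero_right, hx, lineCell_add]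
  | upper g i x u j hj hx =>
    change faceCell g i x 1 = edgeCell _ _ u
    rw [faceCell_one_right, hx, lineCell_add]

/-- The index of the open cell that contains a given point of `X_{m,n}`. -/
noncomputable def cellOf : X m n → CellIndex m n :=
  Quot.lift preCell fun _ _ h => preCell_eq_of_glue h

/-- The projection from the disjoint union of the closed cells to `X_{m,n}`. -/
def toX (p : DisjointCells m n) : X m n := Quot.mk _ p

lemma toX_eq_of_glue {p q : DisjointCells m n} (h : Glue m n p q) : toX p = toX q := Quot.sound h

@[simp] lemma cellOf_toX (p : DisjointCells m n) : cellOf (toX p) = preCell p := rfl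

lemma toX_surjective : Function.Surjective (toX : DisjointCells m n → X m n) :=
  Quot.mk_surjective

lemma mem_Ioo_iff_ne {u : unitInterval} : u ∈ Set.Ioo (0 : unitInterval) 1 ↔ u ≠ 0 ∧ u ≠ 1 := by
  rw [Set.mem_Ioo, unitInterval.pos_iff_ne_zero, unitInterval.lt_one_iff_ne_one]

lemma preCell_of_mem_interior {c : CellIndex m n} {p : c.Model} (hp : p ∈ c.interior) :
    preCell ⟨c, p⟩ = c := by
  cases c with
  | vertex g => rfl
  | edge g x =>
    have h := mem_Ioo_iff_ne.1 hp
    exact edgeCell_of_ne g x h.1 h.2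
  | face g i =>
    have h1 := mem_Ioo_iff_ne.1 hp.1
    have h2 := mem_Ioo_iff_ne.1 hp.2
    exact faceCell_of_ne g i h1.1 h1.2 h2.1 h2.2

/-- The affine embedding of the unit interval onto the `j`-th of `N` equal pieces of it. -/
noncomputable def segment {N : ℕ} (j : Fin N) (u : unitInterval) : unitInterval :=
  ⟨((j : ℕ) + (u : ℝ)) / N, by
    have hN : (0 : ℝ) < N := Nat.cast_pos.2 (Nat.zero_lt_of_lt j.2)
    have h1 : ((j : ℕ) : ℝ) + 1 ≤ N := by exact_mod_cast j.2
    have h2 := u.2.1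
    have h3 := u.2.2
    constructor
    · positivity
    · rw [div_le_one hN]; linarith⟩

lemma segment_mul {N : ℕ} (j : Fin N) (u : unitInterval) :
    (segment j u : ℝ) * N = (j : ℕ) + u := by
  have hN : (0 : ℝ) < N := Nat.cast_pos.2 (Nat.zero_lt_of_lt j.2)
  simp only [segment]
  field_simp

lemma continuous_segment {N : ℕ} (j : Fin N) : Continuous (segment j) := by
  unfold segment
  fun_prop

lemma exists_segment_eq {N : ℕ} (hN : 0 < N) (x : unitInterval) :
    ∃ (j : Fin N) (u : unitInterval), segment j u = x := by
  have hN' : (0 : ℝ) < N := Nat.cast_pos.2 hN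
  rcases eq_or_ne x 1 with rfl | h1
  · refine ⟨⟨N - 1, by omega⟩, 1, Subtype.ext ?_⟩
    simp only [segment, Set.Icc.coe_one]
    rw [div_eq_one_iff_eq hN'.ne', Nat.cast_sub hN]
    simp
  · have hx : (x : ℝ) < 1 := lt_of_le_of_ne x.2.2 fun h => h1 (Subtype.ext h)
    have h0 : 0 ≤ (x : ℝ) * N := mul_nonneg x.2.1 hN'.le
    refine ⟨⟨⌊(x : ℝ) * N⌋₊, ?_⟩, ⟨(x : ℝ) * N - ⌊(x : ℝ) * N⌋₊, ?_, ?_⟩, Subtype.ext ?_⟩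
    · rw [Nat.floor_lt h0]
      nlinarith
    · linarith [Nat.floor_le h0]
    · linarith [Nat.lt_floor_add_one ((x : ℝ) * N)]
    · simp only [segment]
      field_simp
      ring

lemma toX_left (g : PiOne m n) (i : ZMod (m.gcd n)) (y : unitInterval) :
    toX (ptF g i 0 y) = toX (ptE g (.t i) y) := toX_eq_of_glue (.left g i y)

lemma toX_right (g : PiOne m n) (i : ZMod (m.gcd n)) (y : unitInterval) :
    toX (ptF g i 1 y) = toX (ptE (g * gen m n .a ^ (n / m.gcd n)) (.t (i + 1)) y) :=
  toX_eq_of_glue (.right g i y)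

lemma toX_lower (g : PiOne m n) (i : ZMod (m.gcd n)) (j : Fin (n / m.gcd n)) (u : unitInterval) :
    toX (ptF g i (segment j u) 0) = toX (ptE (g * gen m n .a ^ (j : ℕ)) .a u) :=
  toX_eq_of_glue (.lower g i _ u j j.2 (segment_mul j u))

lemma toX_upper (g : PiOne m n) (i : ZMod (m.gcd n)) (j : Fin (m / m.gcd n)) (u : unitInterval) :
    toX (ptF g i (segment j u) 1) =
      toX (ptE (g * gen m n (.t i) * gen m n .a ^ (j : ℕ)) .a u) :=
  toX_eq_of_glue (.upper g i _ u j j.2 (segment_mul j u))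

lemma div_gcd_pos_left (hm : 1 ≤ m) : 0 < m / m.gcd n :=
  Nat.div_pos (Nat.gcd_le_left n hm) (Nat.gcd_pos_of_pos_left n hm)

lemma div_gcd_pos_right (hn : 1 ≤ n) : 0 < n / m.gcd n :=
  Nat.div_pos (Nat.gcd_le_right m hn) (Nat.gcd_pos_of_pos_right m hn)

lemma exists_interior_of_edge (g : PiOne m n) (x : Gen (m.gcd n)) (u : unitInterval) :
    ∃ (c : CellIndex m n) (p : c.Model), p ∈ c.interior ∧ toX ⟨c, p⟩ = toX (ptE g x u) := by
  by_cases h0 : u = 0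
  · subst h0
    exact ⟨.vertex g, (), trivial, (toX_eq_of_glue (.source g x)).symm⟩
  by_cases h1 : u = 1
  · subst h1
    exact ⟨.vertex _, (), trivial, (toX_eq_of_glue (.target g x)).symm⟩
  exact ⟨.edge g x, u, mem_Ioo_iff_ne.2 ⟨h0, h1⟩, rfl⟩

lemma exists_interior (hm : 1 ≤ m) (hn : 1 ≤ n) (z : X m n) :
    ∃ (c : CellIndex m n) (p : c.Model), p ∈ c.interior ∧ toX ⟨c, p⟩ = z := by
  obtain ⟨⟨c, w⟩, rfl⟩ := toX_surjective z
  cases c with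
  | vertex g => exact ⟨.vertex g, w, trivial, rfl⟩
  | edge g x => exact exists_interior_of_edge g x w
  | face g i =>
    obtain ⟨x, y⟩ := w
    change ∃ (c : CellIndex m n) (p : c.Model), p ∈ c.interior ∧ toX ⟨c, p⟩ = toX (ptF g i x y)
    by_cases h0 : x = 0
    · subst h0; rw [toX_left]; exact exists_interior_of_edge _ _ _
    by_cases h1 : x = 1
    · subst h1; rw [toX_right]; exact exists_interior_of_edge _ _ _
    by_cases h2 : y = 0
    · subst h2
      obtain ⟨j, u, rfl⟩ := exists_segment_eq (div_gcd_pos_right (m := m) hn) x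
      rw [toX_lower]; exact exists_interior_of_edge _ _ _
    by_cases h3 : y = 1
    · subst h3
      obtain ⟨j, u, rfl⟩ := exists_segment_eq (div_gcd_pos_left (n := n) hm) x
      rw [toX_upper]; exact exists_interior_of_edge _ _ _
    exact ⟨.face g i, (x, y), ⟨mem_Ioo_iff_ne.2 ⟨h0, h1⟩, mem_Ioo_iff_ne.2 ⟨h2, h3⟩⟩, rfl⟩

/-- The open cells partition `X_{m,n}`. -/
lemma mem_openCell_iff (hm : 1 ≤ m) (hn : 1 ≤ n) {z : X m n} {c : CellIndex m n} :
    z ∈ openCell c ↔ cellOf z = c := by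
  constructor
  · rintro ⟨p, hp, rfl⟩
    exact preCell_of_mem_interior hp
  · rintro rfl
    obtain ⟨c, p, hp, rfl⟩ := exists_interior hm hn z
    rw [cellOf_toX, preCell_of_mem_interior hp]
    exact ⟨p, hp, rfl⟩

lemma openCell_nonempty (c : CellIndex m n) : (openCell c).Nonempty := by
  have h : (Set.Ioo (0 : unitInterval) 1).Nonempty := Set.nonempty_Ioo.2 zero_lt_one
  obtain ⟨u, hu⟩ := h
  cases c with
  | vertex g => exact ⟨_, (), trivial, rfl⟩
  | edge g x => exact ⟨_, u, hu, rfl⟩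
  | face g i => exact ⟨_, (u, u), ⟨hu, hu⟩, rfl⟩

lemma openCell_injective (hm : 1 ≤ m) (hn : 1 ≤ n) :
    Function.Injective (openCell : CellIndex m n → Set (X m n)) := by
  intro c d h
  obtain ⟨z, hz⟩ := openCell_nonempty c
  have hz' : z ∈ openCell d := h ▸ hz
  rw [mem_openCell_iff hm hn] at hz hz'
  rw [← hz, hz']

/-! ### Incidence of cells -/

/-- A cell `d` is incident to a cell `c` if the open cell `d` meets the closed cell `c`. -/
def Incident (c d : CellIndex m n) : Prop := ∃ p : c.Model, preCell ⟨c, p⟩ = d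

lemma incident_vertex {g : PiOne m n} {d : CellIndex m n} :
    Incident (.vertex g) d ↔ d = .vertex g :=
  ⟨fun ⟨_, h⟩ => h.symm, fun h => ⟨(), h.symm⟩⟩

lemma exists_ne_zero_ne_one : ∃ u : unitInterval, u ≠ 0 ∧ u ≠ 1 := by
  obtain ⟨u, hu⟩ : (Set.Ioo (0 : unitInterval) 1).Nonempty := Set.nonempty_Ioo.2 zero_lt_one
  exact ⟨u, mem_Ioo_iff_ne.1 hu⟩

lemma incident_edge {g : PiOne m n} {x : Gen (m.gcd n)} {d : CellIndex m n} :
    Incident (.edge g x) d ↔ d = .edge g x ∨ d = .vertex g ∨ d = .vertex (g * gen m n x) := by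
  constructor
  · rintro ⟨u, rfl⟩
    by_cases h0 : u = (0 : unitInterval)
    · subst h0; exact Or.inr (Or.inl (edgeCell_zero g x))
    by_cases h1 : u = (1 : unitInterval)
    · subst h1; exact Or.inr (Or.inr (edgeCell_one g x))
    exact Or.inl (edgeCell_of_ne g x h0 h1)
  · obtain ⟨u, h0, h1⟩ := exists_ne_zero_ne_one
    rintro (rfl | rfl | rfl)
    · exact ⟨u, edgeCell_of_ne g x h0 h1⟩
    · exact ⟨(0 : unitInterval), edgeCell_zero g x⟩
    · exact ⟨(1 : unitInterval), edgeCell_one g x⟩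

/-- The boundary of a face: the left and the right edge, the lower path, and the upper path. -/
lemma incident_face (hm : 1 ≤ m) (hn : 1 ≤ n) {g : PiOne m n} {i : ZMod (m.gcd n)}
    {d : CellIndex m n} :
    Incident (.face g i) d ↔ d = .face g i ∨ Incident (.edge g (.t i)) d ∨
      Incident (.edge (g * gen m n .a ^ (n / m.gcd n)) (.t (i + 1))) d ∨
      (∃ j < n / m.gcd n, Incident (.edge (g * gen m n .a ^ j) .a) d) ∨
      ∃ j < m / m.gcd n, Incident (.edge (g * gen m n (.t i) * gen m n .a ^ j) .a) d := by
  constructor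
  · rintro ⟨⟨x, y⟩, rfl⟩
    change faceCell g i x y = _ ∨ _
    by_cases h0 : x = 0
    · subst h0; exact Or.inr (Or.inl ⟨y, (faceCell_zero_left g i y).symm⟩)
    by_cases h1 : x = 1
    · subst h1; exact Or.inr (Or.inr (Or.inl ⟨y, (faceCell_one_left g i y).symm⟩))
    by_cases h2 : y = 0
    · subst h2
      obtain ⟨j, u, rfl⟩ := exists_segment_eq (div_gcd_pos_right (m := m) hn) x
      exact Or.inr (Or.inr (Or.inr (Or.inl ⟨j, j.2, u,
        congrArg cellOf (toX_lower g i j u).symm⟩)))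
    by_cases h3 : y = 1
    · subst h3
      obtain ⟨j, u, rfl⟩ := exists_segment_eq (div_gcd_pos_left (n := n) hm) x
      exact Or.inr (Or.inr (Or.inr (Or.inr ⟨j, j.2, u,
        congrArg cellOf (toX_upper g i j u).symm⟩)))
    exact Or.inl (faceCell_of_ne g i h0 h1 h2 h3)
  · obtain ⟨u, h0, h1⟩ := exists_ne_zero_ne_one
    rintro (rfl | ⟨y, rfl⟩ | ⟨y, rfl⟩ | ⟨j, hj, u, rfl⟩ | ⟨j, hj, u, rfl⟩)
    · exact ⟨(u, u), faceCell_of_ne g i h0 h1 h0 h1⟩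
    · exact ⟨((0 : unitInterval), y), faceCell_zero_left g i y⟩
    · exact ⟨((1 : unitInterval), y), faceCell_one_left g i y⟩
    · exact ⟨(segment ⟨j, hj⟩ u, (0 : unitInterval)), congrArg cellOf (toX_lower g i ⟨j, hj⟩ u)⟩
    · exact ⟨(segment ⟨j, hj⟩ u, (1 : unitInterval)), congrArg cellOf (toX_upper g i ⟨j, hj⟩ u)⟩

lemma Incident.trans (hm : 1 ≤ m) (hn : 1 ≤ n) {c d e : CellIndex m n} (h : Incident c d)
    (h' : Incident d e) : Incident c e := by
  have key : ∀ {g x d}, Incident (m := m) (n := n) (.edge g x) d → Incident d e →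
      Incident (.edge g x) e := by
    intro g x d h h'
    rcases incident_edge.1 h with rfl | rfl | rfl
    · exact h'
    · rw [incident_vertex.1 h', incident_edge]; simp
    · rw [incident_vertex.1 h', incident_edge]; simp
  cases c with
  | vertex g => rw [incident_vertex.1 h] at h'; exact h'
  | edge g x => exact key h h'
  | face g i =>
    rcases (incident_face hm hn).1 h with rfl | h | h | ⟨j, hj, h⟩ | ⟨j, hj, h⟩
    · exact h'
    · exact (incident_face hm hn).2 (Or.inr (Or.inl (key h h')))
    · exact (incident_face hm hn).2 (Or.inr (Or.inr (Or.inl (key h h'))))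
    · exact (incident_face hm hn).2 (Or.inr (Or.inr (Or.inr (Or.inl ⟨j, hj, key h h'⟩))))
    · exact (incident_face hm hn).2 (Or.inr (Or.inr (Or.inr (Or.inr ⟨j, hj, key h h'⟩))))

lemma incident_self (c : CellIndex m n) : Incident c c := by
  obtain ⟨_, p, hp, -⟩ := openCell_nonempty c
  exact ⟨p, preCell_of_mem_interior hp⟩

lemma continuous_toX : Continuous (toX : DisjointCells m n → X m n) := continuous_quot_mk

lemma continuous_toX_mk (c : CellIndex m n) : Continuous fun p : c.Model => toX ⟨c, p⟩ :=
  continuous_toX.comp continuous_sigmaMk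

/-- A union of open cells that contains the boundary of each of its cells is closed. -/
lemma isClosed_subcomplex (hm : 1 ≤ m) (hn : 1 ≤ n) {S : Set (CellIndex m n)}
    (hS : ∀ c ∈ S, ∀ d, Incident c d → d ∈ S) : IsClosed (cellOf ⁻¹' S : Set (X m n)) := by
  have hE : ∀ (g : PiOne m n) (x : Gen (m.gcd n)), IsClosed {u | edgeCell g x u ∈ S} := by
    intro g x
    by_cases h : .edge g x ∈ S
    · convert isClosed_univ
      exact Set.eq_univ_of_forall fun u => hS _ h _ ⟨u, rfl⟩
    · refine Set.Finite.isClosed (Set.Finite.subset (Set.toFinite {0, 1}) fun u hu => ?_)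
      by_contra hu'
      simp only [Set.mem_insert_iff, Set.mem_singleton_iff, not_or] at hu'
      rw [Set.mem_ofPred_eq, edgeCell_of_ne g x hu'.1 hu'.2] at hu
      exact h hu
  have hF : ∀ (g : PiOne m n) (i : ZMod (m.gcd n)),
      IsClosed {w : unitInterval × unitInterval | faceCell g i w.1 w.2 ∈ S} := by
    intro g i
    by_cases h : .face g i ∈ S
    · convert isClosed_univ
      exact Set.eq_univ_of_forall fun w => hS _ h _ ⟨w, rfl⟩
    -- The part of the boundary of the square that lies in the subcomplex is a finite union of
    -- images of compact sets.
    · have hseg : ∀ (σ : unitInterval → unitInterval × unitInterval) (g' x), Continuous σ →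
          IsClosed (σ '' {u | edgeCell (m := m) (n := n) g' x u ∈ S}) := fun σ g' x hσ =>
        ((hE g' x).isCompact.image hσ).isClosed
      have hlow : ∀ (j : Fin (n / m.gcd n)) u, faceCell g i (segment j u) 0 =
          edgeCell (g * gen m n .a ^ (j : ℕ)) .a u := fun j u =>
        congrArg cellOf (toX_lower g i j u)
      have hupp : ∀ (j : Fin (m / m.gcd n)) u, faceCell g i (segment j u) 1 =
          edgeCell (g * gen m n (.t i) * gen m n .a ^ (j : ℕ)) .a u := fun j u =>
        congrArg cellOf (toX_upper g i j u)
      convert ((hseg (fun y => (0, y)) g (.t i) (by fun_prop)).union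
        (hseg (fun y => (1, y)) (g * gen m n .a ^ (n / m.gcd n)) (.t (i + 1))
          (by fun_prop))).union
        ((isClosed_iUnion_of_finite fun j : Fin (n / m.gcd n) =>
          hseg (fun u => (segment j u, 0)) (g * gen m n .a ^ (j : ℕ)) .a
            ((continuous_segment j).prodMk continuous_const)).union
        (isClosed_iUnion_of_finite fun j : Fin (m / m.gcd n) =>
          hseg (fun u => (segment j u, 1)) (g * gen m n (.t i) * gen m n .a ^ (j : ℕ)) .a
            ((continuous_segment j).prodMk continuous_const))) using 1
      ext ⟨x, y⟩
      simp only [Set.mem_ofPred_eq, Set.mem_union, Set.mem_image, Set.mem_iUnion, Prod.mk.injEq]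
      constructor
      · intro hw
        by_cases h0 : x = 0
        · subst h0; rw [faceCell_zero_left] at hw; exact Or.inl (Or.inl ⟨y, hw, rfl, rfl⟩)
        by_cases h1 : x = 1
        · subst h1; rw [faceCell_one_left] at hw; exact Or.inl (Or.inr ⟨y, hw, rfl, rfl⟩)
        by_cases h2 : y = 0
        · subst h2
          obtain ⟨j, u, rfl⟩ := exists_segment_eq (div_gcd_pos_right (m := m) hn) x
          rw [hlow] at hw
          exact Or.inr (Or.inl ⟨j, u, hw, rfl, rfl⟩)
        by_cases h3 : y = 1
        · subst h3
          obtain ⟨j, u, rfl⟩ := exists_segment_eq (div_gcd_pos_left (n := n) hm) x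
          rw [hupp] at hw
          exact Or.inr (Or.inr ⟨j, u, hw, rfl, rfl⟩)
        rw [faceCell_of_ne g i h0 h1 h2 h3] at hw
        exact absurd hw h
      · rintro ((⟨u, hu, rfl, rfl⟩ | ⟨u, hu, rfl, rfl⟩) |
          (⟨j, u, hu, rfl, rfl⟩ | ⟨j, u, hu, rfl, rfl⟩))
        · rwa [faceCell_zero_left]
        · rwa [faceCell_one_left]
        · rwa [hlow]
        · rwa [hupp]
  have h : IsClosed (toX ⁻¹' (cellOf ⁻¹' S) : Set (DisjointCells m n)) := by
    rw [isClosed_sigma_iff]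
    rintro (g | ⟨g, x⟩ | ⟨g, i⟩)
    · exact isClosed_discrete (α := Unit) _
    · exact hE g x
    · exact hF g i
  exact (isQuotientMap_quot_mk (r := Glue m n)).isClosed_preimage.1 h

lemma dense_interior (c : CellIndex m n) : closure c.interior = Set.univ := by
  have h : closure (Set.Ioo (0 : unitInterval) 1) = Set.univ := by
    rw [closure_Ioo zero_ne_one]
    exact Set.eq_univ_of_forall fun u => ⟨unitInterval.nonneg', unitInterval.le_one'⟩
  cases c with
  | vertex g => exact closure_univ (X := Unit)
  | edge g x => exact h
  | face g i =>
    change closure (Set.Ioo (0 : unitInterval) 1 ×ˢ Set.Ioo (0 : unitInterval) 1) = Set.univ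
    rw [closure_prod_eq, h, Set.univ_prod_univ]

/-- Incidence is a topological notion: `d` is incident to `c` if and only if the open cell `d` meets
the closure of the open cell `c`. -/
lemma incident_iff (hm : 1 ≤ m) (hn : 1 ≤ n) {c d : CellIndex m n} :
    Incident c d ↔ (openCell d ∩ closure (openCell c)).Nonempty := by
  constructor
  · rintro ⟨p, hp⟩
    refine ⟨toX ⟨c, p⟩, (mem_openCell_iff hm hn).2 hp, ?_⟩
    exact image_closure_subset_closure_image (continuous_toX_mk c)
      ⟨p, by rw [dense_interior]; trivial, rfl⟩
  · rintro ⟨z, hz, hz'⟩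
    have h := closure_minimal (s := openCell c) (t := cellOf ⁻¹' {d | Incident c d}) (fun w hw => by
      rw [Set.mem_preimage, (mem_openCell_iff hm hn).1 hw]; exact incident_self c)
      (isClosed_subcomplex hm hn fun _ h _ h' => Incident.trans hm hn h h')
    have h2 := h hz'
    rwa [Set.mem_preimage, (mem_openCell_iff hm hn).1 hz] at h2

/-! ### Automorphisms as permutations of cell indices -/

lemma openCell_mem_openCells (c : CellIndex m n) : openCell c ∈ openCells m n c.dim :=
  ⟨c, rfl, rfl⟩

/-- The cells of `X_{m,n}` correspond to their indices. -/
noncomputable def cellEquiv (hm : 1 ≤ m) (hn : 1 ≤ n) : CellIndex m n ≃ Cells (openCells m n) :=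
  Equiv.ofBijective (fun c => ⟨openCell c, c.dim, openCell_mem_openCells c⟩)
    ⟨fun _ _ h => openCell_injective hm hn (congrArg Subtype.val h),
      fun ⟨_, _, c, _, hc⟩ => ⟨c, Subtype.ext hc⟩⟩

/-- The action of `Aut(X_{m,n})` on the indices of the cells. -/
noncomputable def indexPerm (hm : 1 ≤ m) (hn : 1 ≤ n) : AutX m n →* Equiv.Perm (CellIndex m n) :=
  (cellEquiv hm hn).symm.permCongrHom.toMonoidHom.comp (cellPerm (openCells m n))

lemma cellEquiv_indexPerm (hm : 1 ≤ m) (hn : 1 ≤ n) (f : AutX m n) (c : CellIndex m n) :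
    cellEquiv hm hn (indexPerm hm hn f c) = cellPerm (openCells m n) f (cellEquiv hm hn c) := by
  change cellEquiv hm hn ((cellEquiv hm hn).symm _) = _
  rw [Equiv.apply_symm_apply]
  rfl

lemma cellPerm_eq_iff (hm : 1 ≤ m) (hn : 1 ≤ n) {f : AutX m n} {c d : CellIndex m n} :
    cellPerm (openCells m n) f (cellEquiv hm hn c) = cellEquiv hm hn d ↔
      indexPerm hm hn f c = d := by
  rw [← cellEquiv_indexPerm, (cellEquiv hm hn).injective.eq_iff]

lemma cellPerm_vertexCell_iff (hm : 1 ≤ m) (hn : 1 ≤ n) {f : AutX m n} {g h : PiOne m n} :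
    cellPerm (openCells m n) f (vertexCell g) = vertexCell h ↔
      indexPerm hm hn f (.vertex g) = .vertex h :=
  cellPerm_eq_iff hm hn

lemma indexPerm_injective (hm : 1 ≤ m) (hn : 1 ≤ n) :
    Function.Injective (indexPerm hm hn : AutX m n → _) :=
  (cellEquiv hm hn).symm.permCongrHom.injective.comp
    (QuotientGroup.kerLift_injective (permHom (openCells m n)))

lemma openCell_indexPerm_mk (hm : 1 ≤ m) (hn : 1 ≤ n) (φ : AutTop (openCells m n))
    (c : CellIndex m n) :
    openCell (indexPerm hm hn (QuotientGroup.mk φ : AutX m n) c) = φ.1 '' openCell c :=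
  congrArg Subtype.val (cellEquiv_indexPerm hm hn (QuotientGroup.mk φ : AutX m n) c)

lemma dim_indexPerm (hm : 1 ≤ m) (hn : 1 ≤ n) (f : AutX m n) (c : CellIndex m n) :
    (indexPerm hm hn f c).dim = c.dim := by
  obtain ⟨φ, rfl⟩ := QuotientGroup.mk_surjective f
  obtain ⟨d, hd, h⟩ := (φ.2 c.dim (openCell c)).2 (openCell_mem_openCells c)
  rw [← hd]
  exact congrArg _ (openCell_injective hm hn ((openCell_indexPerm_mk hm hn φ c).trans h.symm))

lemma incident_indexPerm (hm : 1 ≤ m) (hn : 1 ≤ n) (f : AutX m n) (c d : CellIndex m n) :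
    Incident (indexPerm hm hn f c) (indexPerm hm hn f d) ↔ Incident c d := by
  obtain ⟨φ, rfl⟩ := QuotientGroup.mk_surjective f
  have h1 := openCell_indexPerm_mk hm hn φ c
  have h2 := openCell_indexPerm_mk hm hn φ d
  rw [incident_iff hm hn, incident_iff hm hn]
  rw [h1, h2, ← φ.1.image_closure, ← Set.image_inter φ.1.injective, Set.image_nonempty]

/-- A self-homeomorphism of `X_{m,n}` that maps cells to cells as prescribed by a
dimension-preserving permutation of the indices comes from an automorphism. -/
lemma exists_aut_of_homeomorph (hm : 1 ≤ m) (hn : 1 ≤ n) (φ : X m n ≃ₜ X m n)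
    (F : Equiv.Perm (CellIndex m n)) (hF : ∀ c, (F c).dim = c.dim)
    (h : ∀ z, cellOf (φ z) = F (cellOf z)) : ∃ f : AutX m n, indexPerm hm hn f = F := by
  have himg : ∀ c, φ '' openCell c = openCell (F c) := by
    intro c
    ext z
    obtain ⟨w, rfl⟩ := φ.surjective z
    rw [φ.injective.mem_set_image, mem_openCell_iff hm hn, mem_openCell_iff hm hn, h,
      F.injective.eq_iff]
  have hφ : φ ∈ AutTop (openCells m n) := by
    intro d s
    constructor
    · rintro ⟨c, hc, hcs⟩
      refine ⟨F.symm c, ?_, ?_⟩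
      · rw [← hF, Equiv.apply_symm_apply, hc]
      · apply φ.injective.image_injective
        rw [himg, Equiv.apply_symm_apply, hcs]
    · rintro ⟨c, rfl, rfl⟩
      exact ⟨F c, hF c, (himg c).symm⟩
  refine ⟨(QuotientGroup.mk (⟨φ, hφ⟩ : AutTop (openCells m n)) : AutX m n), Equiv.ext fun c => ?_⟩
  apply openCell_injective hm hn
  exact (openCell_indexPerm_mk hm hn ⟨φ, hφ⟩ c).trans (himg c)

/-- A pair of mutually inverse maps of the disjoint union of the closed cells that are compatible
with the attaching maps and map open cells into open cells gives rise to an automorphism. -/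
lemma exists_aut_of_maps (hm : 1 ≤ m) (hn : 1 ≤ n) (Φ Ψ : DisjointCells m n → DisjointCells m n)
    (hΦ : Continuous Φ) (hΨ : Continuous Ψ)
    (hΦ' : ∀ p q, Glue m n p q → toX (Φ p) = toX (Φ q))
    (hΨ' : ∀ p q, Glue m n p q → toX (Ψ p) = toX (Ψ q))
    (hΨΦ : ∀ p, Ψ (Φ p) = p) (hΦΨ : ∀ p, Φ (Ψ p) = p)
    (F : Equiv.Perm (CellIndex m n)) (hF : ∀ c, (F c).dim = c.dim)
    (h : ∀ c, ∀ p ∈ c.interior, preCell (Φ ⟨c, p⟩) = F c) :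
    ∃ f : AutX m n, indexPerm hm hn f = F := by
  let φ : X m n → X m n := Quot.lift (fun p => toX (Φ p)) hΦ'
  let ψ : X m n → X m n := Quot.lift (fun p => toX (Ψ p)) hΨ'
  refine exists_aut_of_homeomorph hm hn
    { toFun := φ
      invFun := ψ
      left_inv := ?_
      right_inv := ?_
      continuous_toFun := continuous_quot_lift _ (continuous_toX.comp hΦ)
      continuous_invFun := continuous_quot_lift _ (continuous_toX.comp hΨ) } F hF ?_
  · rintro ⟨p⟩
    exact congrArg toX (hΨΦ p)
  · rintro ⟨p⟩
    exact congrArg toX (hΦΨ p)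
  · intro z
    obtain ⟨c, p, hp, rfl⟩ := exists_interior hm hn z
    rw [cellOf_toX, preCell_of_mem_interior hp]
    exact h c p hp

/-! ### Relabellings -/

/-- The cyclic shift of the indices of the loops `t_i`. -/
def shiftGen {k : ℕ} (r : ZMod k) : Gen k → Gen k
  | .a => .a
  | .t i => .t (i + r)

variable (m n) in
/-- A permutation of the vertices of `X_{m,n}` that maps edges to edges in the direction of the
edges: it preserves the edges `a`, and shifts the indices of the edges `t_i` that start at `g` by an
amount which depends only on the branching line of `g`. -/
structure Relabelling where
  /-- the permutation of the vertices -/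
  toPerm : Equiv.Perm (PiOne m n)
  /-- the shift of the indices -/
  shift : PiOne m n → ZMod (m.gcd n)
  map_gen : ∀ g x, toPerm (g * gen m n x) = toPerm g * gen m n (shiftGen (shift g) x)
  shift_mul_a : ∀ g, shift (g * gen m n .a) = shift g

namespace Relabelling

variable (R : Relabelling m n)

lemma map_a_pow (g : PiOne m n) (j : ℕ) :
    R.toPerm (g * gen m n .a ^ j) = R.toPerm g * gen m n .a ^ j := by
  induction j with
  | zero => simp
  | succ j ih => rw [pow_succ, ← mul_assoc, R.map_gen, ih, shiftGen, mul_assoc]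

lemma shift_mul_a_pow (g : PiOne m n) (j : ℕ) : R.shift (g * gen m n .a ^ j) = R.shift g := by
  induction j with
  | zero => simp
  | succ j ih => rw [pow_succ, ← mul_assoc, R.shift_mul_a, ih]

/-- The inverse of a relabelling. -/
def symm : Relabelling m n where
  toPerm := R.toPerm.symm
  shift h := -R.shift (R.toPerm.symm h)
  map_gen h x := by
    obtain ⟨g, rfl⟩ := R.toPerm.surjective h
    rw [Equiv.symm_apply_apply, Equiv.symm_apply_eq, R.map_gen]
    cases x <;> simp [shiftGen]
  shift_mul_a h := by
    obtain ⟨g, rfl⟩ := R.toPerm.surjective h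
    have h1 : R.toPerm g * gen m n .a = R.toPerm (g * gen m n .a) := (R.map_gen g .a).symm
    rw [h1, Equiv.symm_apply_apply, Equiv.symm_apply_apply, R.shift_mul_a]

/-- The effect of a relabelling on the cells. -/
def onIndex : CellIndex m n → CellIndex m n
  | .vertex g => .vertex (R.toPerm g)
  | .edge g x => .edge (R.toPerm g) (shiftGen (R.shift g) x)
  | .face g i => .face (R.toPerm g) (i + R.shift g)

/-- The effect of a relabelling on the points of the closed cells. -/
def onPoints : DisjointCells m n → DisjointCells m n
  | ⟨.vertex g, _⟩ => ptV (R.toPerm g)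
  | ⟨.edge g x, u⟩ => ptE (R.toPerm g) (shiftGen (R.shift g) x) u
  | ⟨.face g i, w⟩ => ptF (R.toPerm g) (i + R.shift g) (w : unitInterval × unitInterval).1
      (w : unitInterval × unitInterval).2

lemma shiftGen_neg_shiftGen {k : ℕ} (r : ZMod k) (x : Gen k) :
    shiftGen (-r) (shiftGen r x) = x := by
  cases x <;> simp [shiftGen]

lemma shiftGen_shiftGen_neg {k : ℕ} (r : ZMod k) (x : Gen k) :
    shiftGen r (shiftGen (-r) x) = x := by
  cases x <;> simp [shiftGen]

lemma symm_onIndex_onIndex (c : CellIndex m n) : R.symm.onIndex (R.onIndex c) = c := by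
  cases c <;> simp [onIndex, symm, shiftGen_neg_shiftGen]

lemma onIndex_symm_onIndex (c : CellIndex m n) : R.onIndex (R.symm.onIndex c) = c := by
  cases c <;> simp [onIndex, symm, shiftGen_shiftGen_neg]

lemma symm_onPoints_onPoints (p : DisjointCells m n) : R.symm.onPoints (R.onPoints p) = p := by
  rcases p with ⟨g | ⟨g, x⟩ | ⟨g, i⟩, w⟩
  · change ptV _ = ptV _
    simp [symm]
  · change ptE _ _ _ = ptE _ _ _
    simp [symm, shiftGen_neg_shiftGen]
  · change ptF _ _ _ _ = ptF _ _ _ _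
    simp [symm]

lemma onPoints_symm_onPoints (p : DisjointCells m n) : R.onPoints (R.symm.onPoints p) = p := by
  rcases p with ⟨g | ⟨g, x⟩ | ⟨g, i⟩, w⟩
  · change ptV _ = ptV _
    simp [symm]
  · change ptE _ _ _ = ptE _ _ _
    simp [symm, shiftGen_shiftGen_neg]
  · change ptF _ _ _ _ = ptF _ _ _ _
    simp [symm]

lemma continuous_onPoints : Continuous R.onPoints := by
  rw [continuous_sigma_iff]
  rintro (g | ⟨g, x⟩ | ⟨g, i⟩)
  · exact continuous_sigmaMk (σ := CellIndex.Model) (i := .vertex (R.toPerm g))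
  · exact continuous_sigmaMk (σ := CellIndex.Model)
      (i := .edge (R.toPerm g) (shiftGen (R.shift g) x))
  · exact continuous_sigmaMk (σ := CellIndex.Model) (i := .face (R.toPerm g) (i + R.shift g))

lemma toX_onPoints_eq {p q : DisjointCells m n} (h : Glue m n p q) :
    toX (R.onPoints p) = toX (R.onPoints q) := by
  apply toX_eq_of_glue
  induction h with
  | source g x => exact .source _ _
  | target g x =>
    change Glue m n (ptE _ _ _) (ptV _)
    rw [R.map_gen]
    exact .target _ _
  | left g i y => exact .left _ _ _
  | right g i y =>
    change Glue m n (ptF _ _ _ _) (ptE _ _ _)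
    rw [R.map_a_pow, R.shift_mul_a_pow, shiftGen, add_right_comm]
    exact .right _ _ _
  | lower g i x u j hj hx =>
    change Glue m n (ptF _ _ _ _) (ptE _ _ _)
    rw [R.map_a_pow]
    exact .lower _ _ _ _ _ hj hx
  | upper g i x u j hj hx =>
    change Glue m n (ptF _ _ _ _) (ptE _ _ _)
    rw [R.map_a_pow, R.map_gen]
    exact .upper _ _ _ _ _ hj hx

/-- The permutation of the cells induced by a relabelling. -/
def indexEquiv : Equiv.Perm (CellIndex m n) :=
  ⟨R.onIndex, R.symm.onIndex, R.symm_onIndex_onIndex, R.onIndex_symm_onIndex⟩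

lemma exists_aut (hm : 1 ≤ m) (hn : 1 ≤ n) : ∃ f : AutX m n, indexPerm hm hn f = R.indexEquiv := by
  refine exists_aut_of_maps hm hn R.onPoints R.symm.onPoints R.continuous_onPoints
    R.symm.continuous_onPoints (fun _ _ => R.toX_onPoints_eq) (fun _ _ => R.symm.toX_onPoints_eq)
    R.symm_onPoints_onPoints R.onPoints_symm_onPoints R.indexEquiv ?_ ?_
  · rintro (g | ⟨g, x⟩ | ⟨g, i⟩) <;> rfl
  · rintro (g | ⟨g, x⟩ | ⟨g, i⟩) p hp
    · rfl
    · exact preCell_of_mem_interior (c := .edge (R.toPerm g) (shiftGen (R.shift g) x)) hp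
    · exact preCell_of_mem_interior (c := .face (R.toPerm g) (i + R.shift g)) hp

end Relabelling

variable (m n) in
/-- Left translation by an element of the fundamental group. -/
def translation (d : PiOne m n) : Relabelling m n where
  toPerm := Equiv.mulLeft d
  shift _ := 0
  map_gen g x := by cases x <;> simp [shiftGen, mul_assoc]
  shift_mul_a _ := rfl

/-- The action of the fundamental group by deck transformations. -/
noncomputable def deck (hm : 1 ≤ m) (hn : 1 ≤ n) : PiOne m n →* AutX m n where
  toFun d := ((translation m n d).exists_aut hm hn).choose
  map_one' := by
    apply indexPerm_injective hm hn
    rw [((translation m n 1).exists_aut hm hn).choose_spec, map_one]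
    ext c : 1
    rcases c with g | ⟨g, x⟩ | ⟨g, i⟩ <;>
      simp [Relabelling.indexEquiv, Relabelling.onIndex, translation]
    cases x <;> simp [shiftGen]
  map_mul' d e := by
    apply indexPerm_injective hm hn
    rw [map_mul, ((translation m n _).exists_aut hm hn).choose_spec,
      ((translation m n _).exists_aut hm hn).choose_spec,
      ((translation m n _).exists_aut hm hn).choose_spec]
    ext c : 1
    rcases c with g | ⟨g, x⟩ | ⟨g, i⟩ <;>
      simp [Relabelling.indexEquiv, Relabelling.onIndex, translation]
    cases x <;> simp [shiftGen]

lemma indexPerm_deck_vertex (hm : 1 ≤ m) (hn : 1 ≤ n) (d g : PiOne m n) :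
    indexPerm hm hn (deck hm hn d) (.vertex g) = .vertex (d * g) := by
  have h : indexPerm hm hn (deck hm hn d) = _ :=
    ((translation m n d).exists_aut hm hn).choose_spec
  rw [h]
  rfl

/-! ### The reflection -/

variable (m n) in
/-- The automorphism of the fundamental group that maps `a` to `a⁻¹` and `t_i` to `t_{-i}`. -/
def reflectHom : PiOne m n →* PiOne m n :=
  PresentedGroup.toGroup (f := fun x => match x with
    | .a => (gen m n .a)⁻¹
    | .t i => gen m n (.t (-i))) (by
    rintro _ ⟨i, rfl⟩
    have h := gen_relation (-(i + 1))
    rw [neg_add, neg_add_cancel_right] at h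
    simp only [boundaryWord, map_mul, map_pow, map_inv, FreeGroup.lift_apply_of]
    rw [mul_inv_eq_one, mul_inv_eq_iff_eq_mul, inv_pow, inv_pow, mul_inv_eq_iff_eq_mul, mul_assoc,
      neg_add, h, inv_mul_cancel_left])

@[simp] lemma reflectHom_a : reflectHom m n (gen m n .a) = (gen m n .a)⁻¹ :=
  PresentedGroup.toGroup.of _

@[simp] lemma reflectHom_t (i : ZMod (m.gcd n)) :
    reflectHom m n (gen m n (.t i)) = gen m n (.t (-i)) :=
  PresentedGroup.toGroup.of _

@[simp] lemma reflectHom_reflectHom (g : PiOne m n) : reflectHom m n (reflectHom m n g) = g := by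
  have h : (reflectHom m n).comp (reflectHom m n) = MonoidHom.id _ := by
    refine PresentedGroup.ext fun x => ?_
    change reflectHom m n (reflectHom m n (gen m n x)) = gen m n x
    cases x <;> simp
  exact DFunLike.congr_fun h g

/-- The effect of the reflection on the cells: the edges `a` are reversed, and the faces are
flipped horizontally. -/
def reflectIndex : CellIndex m n → CellIndex m n
  | .vertex g => .vertex (reflectHom m n g)
  | .edge g .a => .edge (reflectHom m n g * (gen m n .a)⁻¹) .a
  | .edge g (.t i) => .edge (reflectHom m n g) (.t (-i))
  | .face g i => .face (reflectHom m n g * (gen m n .a ^ (n / m.gcd n))⁻¹) (-(i + 1))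

/-- The effect of the reflection on the points of the closed cells. -/
def reflectPoints : DisjointCells m n → DisjointCells m n
  | ⟨.vertex g, _⟩ => ptV (reflectHom m n g)
  | ⟨.edge g .a, u⟩ =>
    ptE (reflectHom m n g * (gen m n .a)⁻¹) .a (unitInterval.symm (u : unitInterval))
  | ⟨.edge g (.t i), u⟩ => ptE (reflectHom m n g) (.t (-i)) u
  | ⟨.face g i, w⟩ => ptF (reflectHom m n g * (gen m n .a ^ (n / m.gcd n))⁻¹) (-(i + 1))
      (unitInterval.symm (w : unitInterval × unitInterval).1)
      (w : unitInterval × unitInterval).2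

lemma reflectIndex_reflectIndex (c : CellIndex m n) : reflectIndex (reflectIndex c) = c := by
  rcases c with g | ⟨g, _ | i⟩ | ⟨g, i⟩ <;> simp [reflectIndex]

lemma reflectPoints_reflectPoints (p : DisjointCells m n) :
    reflectPoints (reflectPoints p) = p := by
  rcases p with ⟨g | ⟨g, _ | i⟩ | ⟨g, i⟩, w⟩
  · change ptV _ = ptV _
    simp
  · change ptE _ _ _ = ptE _ _ _
    simp only [map_mul, map_inv, reflectHom_reflectHom, reflectHom_a, inv_inv, mul_inv_cancel_right]
    exact congrArg (ptE g .a) (unitInterval.symm_symm _)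
  · change ptE _ _ _ = ptE _ _ _
    simp
  · change ptF _ _ _ _ = ptF _ _ _ _
    simp

lemma continuous_reflectPoints : Continuous (reflectPoints : DisjointCells m n → _) := by
  rw [continuous_sigma_iff]
  rintro (g | ⟨g, _ | i⟩ | ⟨g, i⟩)
  · exact continuous_sigmaMk (σ := CellIndex.Model) (i := .vertex (reflectHom m n g))
  · exact (continuous_sigmaMk (σ := CellIndex.Model)
      (i := .edge (reflectHom m n g * (gen m n .a)⁻¹) .a)).comp unitInterval.continuous_symm
  · exact continuous_sigmaMk (σ := CellIndex.Model) (i := .edge (reflectHom m n g) (.t (-i)))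
  · exact (continuous_sigmaMk (σ := CellIndex.Model)
      (i := .face (reflectHom m n g * (gen m n .a ^ (n / m.gcd n))⁻¹) (-(i + 1)))).comp
      ((unitInterval.continuous_symm.comp continuous_fst).prodMk continuous_snd :
        Continuous fun w : unitInterval × unitInterval => (unitInterval.symm w.1, w.2))

lemma inv_pow_mul_pow_sub {G : Type*} [Group G] (a : G) {N j : ℕ} (hj : j < N) :
    (a ^ N)⁻¹ * a ^ (N - 1 - j) = a⁻¹ ^ j * a⁻¹ := by
  have h : N = N - 1 - j + (j + 1) := by omega
  rw [inv_mul_eq_iff_eq_mul, ← pow_succ, inv_pow, eq_mul_inv_iff_mul_eq, ← pow_add, ← h]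

lemma toX_reflectPoints_eq {p q : DisjointCells m n} (h : Glue m n p q) :
    toX (reflectPoints p) = toX (reflectPoints q) := by
  have hr : ∀ i : ZMod (m.gcd n),
      (gen m n .a ^ (n / m.gcd n))⁻¹ * gen m n (.t (-(i + 1))) =
        gen m n (.t (-i)) * (gen m n .a ^ (m / m.gcd n))⁻¹ := by
    intro i
    have h := gen_relation (-(i + 1))
    rw [neg_add, neg_add_cancel_right] at h
    rw [inv_mul_eq_iff_eq_mul, ← mul_assoc, eq_mul_inv_iff_mul_eq, neg_add, h]
  have hsymm : ∀ {x u : unitInterval} {N j : ℕ}, j < N → (x : ℝ) * (N : ℕ) = j + u →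
      (unitInterval.symm x : ℝ) * (N : ℕ) = ((N - 1 - j : ℕ) : ℝ) + unitInterval.symm u := by
    intro x u N j hj hx
    have h : ((N - 1 - j : ℕ) : ℝ) = N - 1 - j := by
      rw [Nat.cast_sub (by omega), Nat.cast_sub (by omega), Nat.cast_one]
    rw [h, unitInterval.coe_symm_eq, unitInterval.coe_symm_eq]
    linarith
  induction h with
  | source g x =>
    cases x with
    | a =>
      change toX (ptE _ .a (unitInterval.symm 0)) = toX (ptV _)
      rw [unitInterval.symm_zero, toX_eq_of_glue (.target _ _), inv_mul_cancel_right]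
    | t i => exact toX_eq_of_glue (.source _ _)
  | target g x =>
    cases x with
    | a =>
      change toX (ptE _ .a (unitInterval.symm 1)) = toX (ptV _)
      rw [unitInterval.symm_one, toX_eq_of_glue (.source _ _), map_mul, reflectHom_a]
    | t i =>
      change toX (ptE _ _ _) = toX (ptV _)
      rw [toX_eq_of_glue (.target _ _), map_mul, reflectHom_t]
  | left g i y =>
    change toX (ptF _ _ (unitInterval.symm 0) _) = toX (ptE _ _ _)
    rw [unitInterval.symm_zero, toX_right, inv_mul_cancel_right, neg_add, neg_add_cancel_right]
  | right g i y =>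
    change toX (ptF _ _ (unitInterval.symm 1) _) = toX (ptE _ _ _)
    rw [unitInterval.symm_one, toX_left, map_mul, map_pow, reflectHom_a, inv_pow]
  | lower g i x u j hj hx =>
    change toX (ptF _ _ _ _) = toX (ptE _ _ _)
    rw [toX_eq_of_glue (.lower _ _ _ _ _ (by omega) (hsymm hj hx)), map_mul, map_pow, reflectHom_a,
      mul_assoc, mul_assoc, inv_pow_mul_pow_sub _ hj]
  | upper g i x u j hj hx =>
    change toX (ptF _ _ _ _) = toX (ptE _ _ _)
    rw [toX_eq_of_glue (.upper _ _ _ _ _ (by omega) (hsymm hj hx)), map_mul, map_pow, map_mul,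
      reflectHom_a, reflectHom_t, mul_assoc (reflectHom m n g), hr, ← mul_assoc, mul_assoc,
      inv_pow_mul_pow_sub _ hj, ← mul_assoc]

/-- There is an automorphism that reverses the orientation of all branching lines. -/
lemma exists_reflection (hm : 1 ≤ m) (hn : 1 ≤ n) :
    ∃ f : AutX m n, ∀ g, indexPerm hm hn f (.vertex g) = .vertex (reflectHom m n g) := by
  obtain ⟨f, hf⟩ := exists_aut_of_maps hm hn reflectPoints reflectPoints continuous_reflectPoints
    continuous_reflectPoints (fun _ _ => toX_reflectPoints_eq) (fun _ _ => toX_reflectPoints_eq)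
    reflectPoints_reflectPoints reflectPoints_reflectPoints
    ⟨reflectIndex, reflectIndex, reflectIndex_reflectIndex, reflectIndex_reflectIndex⟩
    (by rintro (g | ⟨g, _ | i⟩ | ⟨g, i⟩) <;> rfl) (by
      have hs : ∀ {u : unitInterval}, u ∈ Set.Ioo (0 : unitInterval) 1 →
          unitInterval.symm u ∈ Set.Ioo (0 : unitInterval) 1 := by
        intro u hu
        rw [mem_Ioo_iff_ne] at hu ⊢
        exact ⟨fun h => hu.2 (by rw [← unitInterval.symm_symm u, h, unitInterval.symm_zero]),
          fun h => hu.1 (by rw [← unitInterval.symm_symm u, h, unitInterval.symm_one])⟩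
      rintro (g | ⟨g, _ | i⟩ | ⟨g, i⟩) p hp
      · rfl
      · exact preCell_of_mem_interior (c := .edge _ .a) (hs hp)
      · exact preCell_of_mem_interior (c := .edge (reflectHom m n g) (.t (-i))) hp
      · exact preCell_of_mem_interior (c := .face _ _)
          (show ((unitInterval.symm p.1, p.2) : unitInterval × unitInterval) ∈ _ from
            ⟨hs hp.1, hp.2⟩))
  exact ⟨f, fun g => by rw [hf]; rfl⟩

/-! ### Heights and the order of `a` -/

lemma gen_induction {P : PiOne m n → Prop} (one : P 1) (mul_gen : ∀ g x, P g → P (g * gen m n x))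
    (mul_inv_gen : ∀ g x, P g → P (g * (gen m n x)⁻¹)) (g : PiOne m n) : P g := by
  have h : g ∈ Subgroup.closure (Set.range (PresentedGroup.of (rels := Set.range (boundaryWord m n))
      )) := by
    rw [PresentedGroup.closure_range_of]; trivial
  induction h using Subgroup.closure_induction_right with
  | one => exact one
  | mul_right g hg x hx ih => obtain ⟨x, rfl⟩ := hx; exact mul_gen _ x ih
  | mul_inv_cancel g hg x hx ih => obtain ⟨x, rfl⟩ := hx; exact mul_inv_gen _ x ih

/-- The homomorphism that maps `a` to `0` and every `t_i` to `1`. -/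
def heightHom (m n : ℕ) : PiOne m n →* Multiplicative ℤ :=
  PresentedGroup.toGroup (f := fun x => match x with
    | .a => 1
    | .t _ => Multiplicative.ofAdd 1) (by
    rintro _ ⟨i, rfl⟩
    simp [boundaryWord])

/-- The height of a vertex: the exponent sum of the letters `t_i`. -/
def height (g : PiOne m n) : ℤ := Multiplicative.toAdd (heightHom m n g)

@[simp] lemma height_one : height (1 : PiOne m n) = 0 := by simp [height]

@[simp] lemma height_mul (g h : PiOne m n) : height (g * h) = height g + height h := by
  simp [height]

@[simp] lemma height_inv (g : PiOne m n) : height g⁻¹ = -height g := by simp [height]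

@[simp] lemma height_pow (g : PiOne m n) (j : ℕ) : height (g ^ j) = j * height g := by
  simp [height]

@[simp] lemma height_zpow (g : PiOne m n) (j : ℤ) : height (g ^ j) = j * height g := by
  simp [height]

@[simp] lemma height_a : height (gen m n .a) = 0 :=
  congrArg Multiplicative.toAdd (PresentedGroup.toGroup.of (x := Gen.a) _)

@[simp] lemma height_t (i : ZMod (m.gcd n)) : height (gen m n (.t i)) = 1 :=
  congrArg Multiplicative.toAdd (PresentedGroup.toGroup.of (x := Gen.t i) _)

/-- The element `a` acts on `ℚ` as a translation under the affine action in which the `t_i` act as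
the multiplication by `n / m`, so that it has infinite order. -/
lemma a_zpow_injective (hm : 1 ≤ m) (hn : 1 ≤ n) :
    Function.Injective fun j : ℤ => gen m n .a ^ j := by
  have hp : ((m / m.gcd n : ℕ) : ℚ) ≠ 0 := Nat.cast_ne_zero.2 (div_gcd_pos_left hm).ne'
  have hq : ((n / m.gcd n : ℕ) : ℚ) ≠ 0 := Nat.cast_ne_zero.2 (div_gcd_pos_right hn).ne'
  let A : Equiv.Perm ℚ := Equiv.addRight 1
  let T : Equiv.Perm ℚ :=
    Equiv.mulRight₀ (((n / m.gcd n : ℕ) : ℚ) / ((m / m.gcd n : ℕ) : ℚ)) (div_ne_zero hq hp)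
  have hA : ∀ (j : ℤ) x, (A ^ j) x = x + j := by
    intro j x
    have hA1 : A⁻¹ = Equiv.addRight (-1) := Equiv.ext fun y => by
      rw [Equiv.Perm.inv_eq_iff_eq]; simp [A]
    induction j using Int.induction_on generalizing x with
    | zero => simp
    | succ j ih => rw [zpow_add_one, Equiv.Perm.mul_apply, ih]; simp [A]; ring
    | pred j ih => rw [zpow_sub_one, Equiv.Perm.mul_apply, ih, hA1]; simp; ring
  have hA' : ∀ (j : ℕ) x, (A ^ j) x = x + j := fun j x => by
    have := hA j x
    rwa [zpow_natCast, Int.cast_natCast] at this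
  let f : Gen (m.gcd n) → Equiv.Perm ℚ := fun x => match x with
    | .a => A
    | .t _ => T
  let ρ : PiOne m n →* Equiv.Perm ℚ := PresentedGroup.toGroup (f := f) (by
    rintro _ ⟨i, rfl⟩
    simp only [boundaryWord, map_mul, map_pow, map_inv, FreeGroup.lift_apply_of, f]
    rw [mul_inv_eq_one, mul_inv_eq_iff_eq_mul]
    ext x
    simp only [Equiv.Perm.mul_apply, hA', T, Equiv.mulRight₀_apply]
    field_simp)
  have hρ : ρ (gen m n .a) = A := PresentedGroup.toGroup.of (x := Gen.a) _
  intro i j hij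
  have h := congrArg (fun g => ρ g 0) hij
  simp only [map_zpow, hρ, hA, zero_add] at h
  exact_mod_cast h

lemma a_zpow_inj (hm : 1 ≤ m) (hn : 1 ≤ n) {i j : ℤ} :
    gen m n .a ^ i = gen m n .a ^ j ↔ i = j :=
  (a_zpow_injective hm hn).eq_iff

/-! ### Twists, and non-discreteness if the greatest common divisor is not one -/

/-- The effect of the stable letter `t_i` on pairs of a height and a vertex, where the index of the
letter is shifted by an amount that depends on the height. -/
def twistStep (c : ℤ → ZMod (m.gcd n)) (i : ZMod (m.gcd n)) : Equiv.Perm (ℤ × PiOne m n) where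
  toFun w := (w.1 + 1, w.2 * gen m n (.t (i + c w.1)))
  invFun w := (w.1 - 1, w.2 * (gen m n (.t (i + c (w.1 - 1))))⁻¹)
  left_inv w := by simp
  right_inv w := by simp

/-- The right action of the fundamental group on pairs of a height and a vertex in which `a` acts by
right multiplication, and `t_i` raises the height by one and acts by right multiplication by a
stable letter with an index shifted according to the height. -/
def twistAction (c : ℤ → ZMod (m.gcd n)) : PiOne m n →* (Equiv.Perm (ℤ × PiOne m n))ᵐᵒᵖ :=
  PresentedGroup.toGroup (f := fun x => match x with
    | .a => MulOpposite.op ((Equiv.refl ℤ).prodCongr (Equiv.mulRight (gen m n .a)))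
    | .t i => MulOpposite.op (twistStep c i)) (by
    have hpow : ∀ (j : ℕ) (w : ℤ × PiOne m n),
        (((Equiv.refl ℤ).prodCongr (Equiv.mulRight (gen m n .a)) : Equiv.Perm (ℤ × PiOne m n)) ^ j)
          w = (w.1, w.2 * gen m n .a ^ j) := by
      intro j w
      induction j with
      | zero => simp
      | succ j ih => rw [pow_succ', Equiv.Perm.mul_apply, ih]; simp [pow_succ, mul_assoc]
    rintro _ ⟨i, rfl⟩
    simp only [boundaryWord, map_mul, map_pow, map_inv, FreeGroup.lift_apply_of]
    rw [mul_inv_eq_one, mul_inv_eq_iff_eq_mul, ← MulOpposite.op_pow, ← MulOpposite.op_pow,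
      ← MulOpposite.op_mul, ← MulOpposite.op_mul]
    congr 1
    ext w : 1
    rw [Equiv.Perm.mul_apply, Equiv.Perm.mul_apply, hpow, hpow]
    simp only [twistStep, Equiv.coe_fn_mk]
    rw [mul_assoc, mul_assoc, gen_relation, add_right_comm])

/-- The map of the vertices that fixes the base vertex, preserves the edges `a`, and shifts the
index of the edges `t_i` that start at height `z` by `c z`. -/
def twist (c : ℤ → ZMod (m.gcd n)) (g : PiOne m n) : PiOne m n :=
  ((twistAction c g).unop (0, 1)).2

lemma twistAction_fst (c : ℤ → ZMod (m.gcd n)) (g : PiOne m n) :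
    ((twistAction c g).unop (0, 1)).1 = height g := by
  have hgen : ∀ x (w : ℤ × PiOne m n),
      ((twistAction c (gen m n x)).unop w).1 = w.1 + height (gen m n x) := by
    intro x w
    have h : twistAction c (gen m n x) = _ := PresentedGroup.toGroup.of _
    rw [h]
    cases x <;> simp [twistStep]
  induction g using gen_induction with
  | one => simp
  | mul_gen g x ih =>
    rw [map_mul, MulOpposite.unop_mul, Equiv.Perm.mul_apply, hgen, ih, height_mul]
  | mul_inv_gen g x ih =>
    have h := hgen x ((twistAction c (g * (gen m n x)⁻¹)).unop (0, 1))
    rw [← Equiv.Perm.mul_apply, ← MulOpposite.unop_mul, ← map_mul, inv_mul_cancel_right, ih] at h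
    rw [height_mul, height_inv]
    omega

lemma twist_one (c : ℤ → ZMod (m.gcd n)) : twist c (1 : PiOne m n) = 1 := by simp [twist]

lemma twist_mul_gen (c : ℤ → ZMod (m.gcd n)) (g : PiOne m n) (x : Gen (m.gcd n)) :
    twist c (g * gen m n x) = twist c g * gen m n (shiftGen (c (height g)) x) := by
  have h : twistAction c (gen m n x) = _ := PresentedGroup.toGroup.of _
  rw [twist, map_mul, MulOpposite.unop_mul, Equiv.Perm.mul_apply, h, ← twistAction_fst c g]
  cases x <;> rfl

lemma twist_mul_inv_gen (c : ℤ → ZMod (m.gcd n)) (g : PiOne m n) (x : Gen (m.gcd n)) :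
    twist c (g * (gen m n x)⁻¹) =
      twist c g * (gen m n (shiftGen (c (height g - height (gen m n x))) x))⁻¹ := by
  have h := twist_mul_gen c (g * (gen m n x)⁻¹) x
  rw [inv_mul_cancel_right, height_mul, height_inv, ← sub_eq_add_neg] at h
  rw [h, mul_inv_cancel_right]

lemma height_shiftGen (r : ZMod (m.gcd n)) (x : Gen (m.gcd n)) :
    height (gen m n (shiftGen r x)) = height (gen m n x) := by
  cases x <;> simp [shiftGen]

lemma height_twist (c : ℤ → ZMod (m.gcd n)) (g : PiOne m n) : height (twist c g) = height g := by
  induction g using gen_induction with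
  | one => simp [twist_one]
  | mul_gen g x ih => rw [twist_mul_gen, height_mul, height_mul, ih, height_shiftGen]
  | mul_inv_gen g x ih =>
    rw [twist_mul_inv_gen, height_mul, height_mul, height_inv, height_inv, ih, height_shiftGen]

lemma twist_twist {c d : ℤ → ZMod (m.gcd n)} (h : ∀ z, c z + d z = 0) (g : PiOne m n) :
    twist d (twist c g) = g := by
  have hs : ∀ z x, shiftGen (d z) (shiftGen (c z) x) = x := by
    intro z x
    cases x <;> simp [shiftGen, add_assoc, h]
  induction g using gen_induction with
  | one => simp [twist_one]
  | mul_gen g x ih => rw [twist_mul_gen, twist_mul_gen, ih, height_twist, hs]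
  | mul_inv_gen g x ih =>
    rw [twist_mul_inv_gen, twist_mul_inv_gen, ih, height_twist, height_shiftGen, hs]

/-- The relabelling of the vertices by a twist. -/
def twistRelabelling (c : ℤ → ZMod (m.gcd n)) : Relabelling m n where
  toPerm := ⟨twist c, twist (-c), twist_twist (by simp), twist_twist (by simp)⟩
  shift g := c (height g)
  map_gen g x := twist_mul_gen c g x
  shift_mul_a g := by simp

variable (m n) in
/-- The shift of the indices by one at a single height. -/
def shiftAt (N : ℕ) : ℤ → ZMod (m.gcd n) := fun z => if z = N then 1 else 0

lemma eventually_shiftAt (z : ℤ) : ∀ᶠ N in Filter.atTop, shiftAt m n N z = 0 := by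
  filter_upwards [Filter.eventually_gt_atTop z.toNat] with N hN
  rw [shiftAt, if_neg (by omega)]

@[simp] lemma shiftGen_zero {k : ℕ} (x : Gen k) : shiftGen 0 x = x := by cases x <;> simp [shiftGen]

lemma eventually_twist (g : PiOne m n) :
    ∀ᶠ N in Filter.atTop, twist (shiftAt m n N) g = g := by
  induction g using gen_induction with
  | one => simp [twist_one]
  | mul_gen g x ih =>
    filter_upwards [ih, eventually_shiftAt (height g)] with N h1 h2
    rw [twist_mul_gen, h1, h2, shiftGen_zero]
  | mul_inv_gen g x ih =>
    filter_upwards [ih, eventually_shiftAt (height g - height (gen m n x))] with N h1 h2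
    rw [twist_mul_inv_gen, h1, h2, shiftGen_zero]

lemma eventually_twistRelabelling (c : CellIndex m n) :
    ∀ᶠ N in Filter.atTop, (twistRelabelling (shiftAt m n N)).indexEquiv c = c := by
  rcases c with g | ⟨g, x⟩ | ⟨g, i⟩
  · filter_upwards [eventually_twist g] with N h
    exact congrArg _ h
  · filter_upwards [eventually_twist g, eventually_shiftAt (height g)] with N h1 h2
    change CellIndex.edge (twist _ g) (shiftGen (shiftAt m n N (height g)) x) = _
    rw [h1, h2, shiftGen_zero]
  · filter_upwards [eventually_twist g, eventually_shiftAt (height g)] with N h1 h2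
    change CellIndex.face (twist _ g) (i + shiftAt m n N (height g)) = _
    rw [h1, h2, add_zero]

/-- The stable letters `t_0` and `t_1` differ if `k ≠ 1`: there is an action on `ℤ/k × Bool` in
which `a` acts as a cyclic shift of order `k` and `t_0` acts as a transposition, and as `m / k` and
`n / k` are not both divisible by `k`, the relation `t_0 a^{m/k} = a^{n/k} t_0` fails there. -/
lemma t_zero_ne_t_one (hm : 1 ≤ m) (hk : m.gcd n ≠ 1) :
    gen m n (.t 0) ≠ gen m n (.t 1) := by
  classical
  set k := m.gcd n with hkdef
  have hk0 : 0 < k := Nat.gcd_pos_of_pos_left n hm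
  have : NeZero k := ⟨hk0.ne'⟩
  have : Fact (1 < k) := ⟨by omega⟩
  set p := m / k with hp
  set q := n / k with hq
  have hpq : ¬ ((p : ZMod k) = 0 ∧ (q : ZMod k) = 0) := by
    rw [ZMod.natCast_eq_zero_iff, ZMod.natCast_eq_zero_iff]
    rintro ⟨h1, h2⟩
    have h3 : k ∣ p.gcd q := Nat.dvd_gcd h1 h2
    rw [Nat.gcd_div_gcd_div_gcd_of_pos_left hm, Nat.dvd_one] at h3
    exact hk h3
  let A : Equiv.Perm (ZMod k × Bool) := (Equiv.addRight (1 : ZMod k)).prodCongr (Equiv.refl Bool)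
  let T : Equiv.Perm (ZMod k × Bool) := Equiv.swap (0, false) (0, true)
  have hA : ∀ (j : ℕ) w, (A ^ j) w = (w.1 + j, w.2) := by
    intro j w
    induction j with
    | zero => simp
    | succ j ih => rw [pow_succ', Equiv.Perm.mul_apply, ih]; simp [A, add_assoc]
  let T' : ℕ → Equiv.Perm (ZMod k × Bool) := fun j => (A ^ (q * j))⁻¹ * T * A ^ (p * j)
  have hAk : A ^ k = 1 := by ext w : 1; rw [hA]; simp
  have hval : ∀ (i : ZMod k), T' (i + 1).val = T' (i.val + 1) := by
    intro i
    have h : ∀ r : ℕ, A ^ (r * (i + 1).val) = A ^ (r * (i.val + 1)) := by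
      intro r
      ext w : 1
      rw [hA, hA]
      simp
    simp only [T', h]
  let f : Gen k → Equiv.Perm (ZMod k × Bool) := fun x => match x with
    | .a => A
    | .t i => T' i.val
  let ρ : PiOne m n →* Equiv.Perm (ZMod k × Bool) := PresentedGroup.toGroup (f := f) (by
    rintro _ ⟨i, rfl⟩
    simp only [boundaryWord, map_mul, map_pow, map_inv, FreeGroup.lift_apply_of, f]
    rw [mul_inv_eq_one, mul_inv_eq_iff_eq_mul, hval]
    simp only [T', ← hkdef, ← hp, ← hq]
    rw [mul_add, mul_add, mul_one, mul_one, add_comm (q * _) q, pow_add A q, pow_add A (p * _),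
      mul_inv_rev]
    simp only [mul_assoc]
    rw [← mul_assoc (A ^ q) (_)⁻¹, ((Commute.refl A).pow_pow q (q * i.val)).inv_right.eq]
    simp [mul_assoc])
  intro h01
  have h := congrArg ρ h01
  have h0 : ρ (gen m n (.t 0)) = T' (0 : ZMod k).val := PresentedGroup.toGroup.of (x := Gen.t 0) _
  have h1 : ρ (gen m n (.t 1)) = T' (1 : ZMod k).val := PresentedGroup.toGroup.of (x := Gen.t 1) _
  rw [h0, h1, ZMod.val_zero, ZMod.val_one] at h
  simp only [T', mul_zero, mul_one, pow_zero, inv_one, one_mul] at h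
  rw [eq_comm, mul_assoc, inv_mul_eq_iff_eq_mul] at h
  have h2 := DFunLike.congr_fun h (0, false)
  rw [Equiv.Perm.mul_apply, Equiv.Perm.mul_apply, hA, hA] at h2
  simp only [T, Equiv.swap_apply_left, zero_add] at h2
  by_cases hp0 : (p : ZMod k) = 0
  · rw [hp0, Equiv.swap_apply_left] at h2
    exact hpq ⟨hp0, (congrArg Prod.fst h2).symm⟩
  · rw [Equiv.swap_apply_of_ne_of_ne (by simp [hp0]) (by simp [hp0])] at h2
    simpa using congrArg Prod.snd h2

/-- If the greatest common divisor is not one, then there is a sequence of non-trivial automorphisms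
that converges to the identity. -/
lemma not_discreteTopology (hm : 1 ≤ m) (hn : 1 ≤ n) (hk : m.gcd n ≠ 1) :
    ¬ DiscreteTopology (AutX m n) := by
  intro hdisc
  choose f hf using fun N : ℕ => (twistRelabelling (shiftAt m n N)).exists_aut hm hn
  have hlim : Filter.Tendsto f Filter.atTop (nhds 1) := by
    refine TopologicalSpace.tendsto_nhds_generateFrom_iff.2 ?_
    rintro _ ⟨σ, τ, rfl⟩ hστ
    obtain ⟨c, rfl⟩ := (cellEquiv hm hn).surjective σ
    filter_upwards [eventually_twistRelabelling c] with N hN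
    change cellPerm _ (f N) _ = τ
    rw [← hστ, map_one, Equiv.Perm.one_apply, cellPerm_eq_iff, hf, hN]
  rw [nhds_discrete, Filter.tendsto_pure] at hlim
  obtain ⟨N, hN⟩ := hlim.exists
  -- The twist at height `N` maps the vertex `t_0 ^ (N + 1)` to `t_0 ^ N t_1`.
  have hfix : ∀ j ≤ N, twist (shiftAt m n N) (gen m n (.t 0) ^ j) = gen m n (.t 0) ^ j := by
    intro j hj
    induction j with
    | zero => simp [twist_one]
    | succ j ih =>
      rw [pow_succ, twist_mul_gen, ih (by omega), shiftAt, if_neg (by simp; omega), shiftGen_zero]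
  have hmove : twist (shiftAt m n N) (gen m n (.t 0) ^ N * gen m n (.t 0)) =
      gen m n (.t 0) ^ N * gen m n (.t 1) := by
    rw [twist_mul_gen, hfix N le_rfl, shiftAt, if_pos (by simp), shiftGen, zero_add]
  have h := hf N
  rw [hN, map_one] at h
  have h2 := DFunLike.congr_fun h (.vertex (gen m n (.t 0) ^ N * gen m n (.t 0)))
  have h3 : gen m n (.t 0) ^ N * gen m n (.t 0) = _ := CellIndex.vertex.inj h2
  exact t_zero_ne_t_one hm hk (mul_left_cancel (h3.trans hmove))

/-! ### Combinatorial automorphisms and vertices -/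

/-- A permutation of the cells that preserves dimensions and incidence. -/
structure IsCellAut (F : Equiv.Perm (CellIndex m n)) : Prop where
  dim : ∀ c, (F c).dim = c.dim
  incident : ∀ c d, Incident (F c) (F d) ↔ Incident c d

lemma isCellAut_indexPerm (hm : 1 ≤ m) (hn : 1 ≤ n) (f : AutX m n) :
    IsCellAut (indexPerm hm hn f) :=
  ⟨dim_indexPerm hm hn f, incident_indexPerm hm hn f⟩

lemma exists_vertex_of_dim {c : CellIndex m n} (h : c.dim = 0) : ∃ g, c = .vertex g := by
  cases c with
  | vertex g => exact ⟨g, rfl⟩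
  | edge g x => cases h
  | face g i => cases h

lemma exists_edge_of_dim {c : CellIndex m n} (h : c.dim = 1) : ∃ g x, c = .edge g x := by
  cases c with
  | vertex g => cases h
  | edge g x => exact ⟨g, x, rfl⟩
  | face g i => cases h

lemma exists_face_of_dim {c : CellIndex m n} (h : c.dim = 2) : ∃ g i, c = .face g i := by
  cases c with
  | vertex g => cases h
  | edge g x => cases h
  | face g i => exact ⟨g, i, rfl⟩

lemma incident_edge_vertex {g h : PiOne m n} {x : Gen (m.gcd n)} :
    Incident (.edge g x) (.vertex h) ↔ h = g ∨ h = g * gen m n x := by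
  simp [incident_edge]

lemma incident_edge_edge {g h : PiOne m n} {x y : Gen (m.gcd n)} :
    Incident (.edge g x) (.edge h y) ↔ h = g ∧ y = x := by
  simp [incident_edge]

/-- The vertices of a face lie on its lower and on its upper path. -/
lemma incident_face_vertex (hm : 1 ≤ m) (hn : 1 ≤ n) {g h : PiOne m n} {i : ZMod (m.gcd n)} :
    Incident (.face g i) (.vertex h) ↔
      (∃ j ≤ n / m.gcd n, h = g * gen m n .a ^ j) ∨
        ∃ j ≤ m / m.gcd n, h = g * gen m n (.t i) * gen m n .a ^ j := by
  rw [incident_face hm hn]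
  simp only [incident_edge_vertex, reduceCtorEq, false_or, mul_assoc, ← pow_succ, ← gen_relation]
  constructor
  · rintro ((rfl | rfl) | (rfl | rfl) | ⟨j, hj, rfl | rfl⟩ | ⟨j, hj, rfl | rfl⟩)
    · exact Or.inl ⟨0, Nat.zero_le _, by simp⟩
    · exact Or.inr ⟨0, Nat.zero_le _, by simp⟩
    · exact Or.inl ⟨_, le_rfl, rfl⟩
    · exact Or.inr ⟨_, le_rfl, rfl⟩
    · exact Or.inl ⟨j, hj.le, rfl⟩
    · exact Or.inl ⟨j + 1, hj, rfl⟩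
    · exact Or.inr ⟨j, hj.le, rfl⟩
    · exact Or.inr ⟨j + 1, hj, rfl⟩
  · have hp := div_gcd_pos_left (n := n) hm
    have hq := div_gcd_pos_right (m := m) hn
    rintro (⟨j, hj, rfl⟩ | ⟨j, hj, rfl⟩)
    · rcases hj.lt_or_eq with hj | rfl
      · exact Or.inr (Or.inr (Or.inl ⟨j, hj, Or.inl rfl⟩))
      · exact Or.inr (Or.inl (Or.inl rfl))
    · rcases hj.lt_or_eq with hj | rfl
      · exact Or.inr (Or.inr (Or.inr ⟨j, hj, Or.inl rfl⟩))
      · exact Or.inr (Or.inl (Or.inr rfl))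

lemma incident_face_edge_a (hm : 1 ≤ m) (hn : 1 ≤ n) {g h : PiOne m n} {i : ZMod (m.gcd n)} :
    Incident (.face g i) (.edge h .a) ↔
      (∃ j < n / m.gcd n, h = g * gen m n .a ^ j) ∨
        ∃ j < m / m.gcd n, h = g * gen m n (.t i) * gen m n .a ^ j := by
  rw [incident_face hm hn]
  simp [incident_edge_edge]

lemma incident_face_edge_t (hm : 1 ≤ m) (hn : 1 ≤ n) {g h : PiOne m n} {i j : ZMod (m.gcd n)} :
    Incident (.face g i) (.edge h (.t j)) ↔
      (h = g ∧ j = i) ∨ (h = g * gen m n .a ^ (n / m.gcd n) ∧ j = i + 1) := by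
  rw [incident_face hm hn]
  simp [incident_edge_edge]

lemma gen_ne_one (hm : 1 ≤ m) (hn : 1 ≤ n) (x : Gen (m.gcd n)) : gen m n x ≠ 1 := by
  intro h
  cases x with
  | a =>
    have := (a_zpow_inj hm hn (i := 1) (j := 0)).1 (by simpa using h)
    omega
  | t i => simpa using congrArg height h

/-- An edge that belongs to three faces. -/
def InThreeFaces (e : CellIndex m n) : Prop :=
  ∃ c₁ c₂ c₃ : CellIndex m n, c₁ ≠ c₂ ∧ c₁ ≠ c₃ ∧ c₂ ≠ c₃ ∧ c₁.dim = 2 ∧ c₂.dim = 2 ∧ c₃.dim = 2 ∧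
    Incident c₁ e ∧ Incident c₂ e ∧ Incident c₃ e

lemma map_zpow_of_map_mul {G : Type*} [Group G] {v : G → G} {a b : G}
    {g : G} (h : ∀ j : ℤ, v (g * a ^ j * a) = v (g * a ^ j) * b) (j : ℤ) :
    v (g * a ^ j) = v g * b ^ j := by
  induction j using Int.induction_on with
  | zero => simp
  | succ j ih => rw [zpow_add_one, ← mul_assoc, h, ih, zpow_add_one, mul_assoc]
  | pred j ih =>
    have h1 := h (-j - 1)
    rw [mul_assoc, ← zpow_add_one, sub_add_cancel, ih] at h1
    rw [zpow_sub_one b, ← mul_assoc, h1, mul_inv_cancel_right]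

/-- A map of the vertices that commutes with the right multiplication by the generators is a left
translation. -/
lemma eq_mul_of_map_mul_gen {v : PiOne m n → PiOne m n}
    (h : ∀ g x, v (g * gen m n x) = v g * gen m n x) (g : PiOne m n) : v g = v 1 * g := by
  induction g using gen_induction with
  | one => simp
  | mul_gen g x ih => rw [h, ih, mul_assoc]
  | mul_inv_gen g x ih =>
    have h1 := h (g * (gen m n x)⁻¹) x
    rw [inv_mul_cancel_right, ih] at h1
    rw [← mul_assoc, h1, mul_inv_cancel_right]

namespace IsCellAut

variable {F : Equiv.Perm (CellIndex m n)}

/-- A combinatorial automorphism permutes the vertices. -/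
lemma exists_vertexMap (hF : IsCellAut F) : ∃ v : PiOne m n → PiOne m n,
    Function.Bijective v ∧ ∀ g, F (.vertex g) = .vertex (v g) := by
  choose v hv using fun g : PiOne m n => exists_vertex_of_dim (hF.dim (.vertex g))
  refine ⟨v, ⟨fun g h hgh => ?_, fun h => ?_⟩, hv⟩
  · have : F (.vertex g) = F (.vertex h) := by rw [hv, hv, hgh]
    exact CellIndex.vertex.inj (F.injective this)
  · obtain ⟨c, hc⟩ := F.surjective (.vertex h)
    obtain ⟨g, rfl⟩ := exists_vertex_of_dim (c := c) (by rw [← hF.dim, hc]; rfl)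
    exact ⟨g, CellIndex.vertex.inj ((hv g).symm.trans hc)⟩

variable {v : PiOne m n → PiOne m n}

/-- A combinatorial automorphism maps edges to edges, together with their endpoints. -/
lemma exists_edge (hm : 1 ≤ m) (hn : 1 ≤ n) (hF : IsCellAut F) (hv : Function.Injective v)
    (hFv : ∀ g, F (.vertex g) = .vertex (v g)) (g : PiOne m n) (x : Gen (m.gcd n)) :
    ∃ h y, F (.edge g x) = .edge h y ∧ ((v g = h ∧ v (g * gen m n x) = h * gen m n y) ∨
      (v g = h * gen m n y ∧ v (g * gen m n x) = h)) := by
  obtain ⟨h, y, hy⟩ := exists_edge_of_dim (hF.dim (.edge g x))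
  refine ⟨h, y, hy, ?_⟩
  have h1 := (hF.incident (.edge g x) (.vertex g)).2 (incident_edge_vertex.2 (Or.inl rfl))
  have h2 := (hF.incident (.edge g x) (.vertex (g * gen m n x))).2
    (incident_edge_vertex.2 (Or.inr rfl))
  rw [hy, hFv, incident_edge_vertex] at h1 h2
  have hne : v g ≠ v (g * gen m n x) := fun h => gen_ne_one hm hn x (by simpa using hv h)
  rcases h1 with h1 | h1 <;> rcases h2 with h2 | h2
  · exact absurd (h1.trans h2.symm) hne
  · exact Or.inl ⟨h1, h2⟩
  · exact Or.inr ⟨h1, h2⟩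
  · exact absurd (h1.trans h2.symm) hne

/-- If the greatest common divisor is one, then the edges and the faces are determined by their
vertices. -/
lemma eq_one_of_vertices (hm : 1 ≤ m) (hn : 1 ≤ n) (hk : m.gcd n = 1) (hF : IsCellAut F)
    (hFv : ∀ g, F (.vertex g) = .vertex g) : F = 1 := by
  have : Subsingleton (ZMod (m.gcd n)) := by rw [hk]; infer_instance
  have hz : ∀ {i j : ℤ}, gen m n .a ^ i = gen m n .a ^ j ↔ i = j := a_zpow_inj hm hn
  ext c : 1
  rw [Equiv.Perm.one_apply]
  rcases c with g | ⟨g, x⟩ | ⟨g, i⟩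
  · exact hFv g
  · obtain ⟨h, y, hy, he⟩ := hF.exists_edge hm hn Function.injective_id hFv g x
    rw [hy]
    rcases he with ⟨h1, h2⟩ | ⟨h1, h2⟩
    · simp only [id] at h1 h2
      subst h1
      rw [mul_left_cancel_iff] at h2
      have h3 := congrArg height h2
      rcases x with _ | i <;> rcases y with _ | j <;> simp at h3
      · rfl
      · rw [Subsingleton.elim i j]
    · simp only [id] at h1 h2
      subst h2
      rw [mul_assoc, left_eq_mul] at h1
      have h3 := congrArg height h1
      rcases x with _ | i <;> rcases y with _ | j <;> simp at h3
      have := (hz (i := 2) (j := 0)).1 (by rw [zpow_ofNat, pow_two, h1, zpow_zero])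
      omega
  · obtain ⟨h, j, hj⟩ := exists_face_of_dim (hF.dim (.face g i))
    have hinc : ∀ w, Incident (.face h j) (.vertex w) ↔ Incident (.face g i) (.vertex w) := by
      intro w
      rw [← hj, ← hF.incident (.face g i), hFv]
    have h1 := (hinc h).1 ((incident_face_vertex hm hn).2 (Or.inl ⟨0, Nat.zero_le _, by simp⟩))
    have h2 := (hinc g).2 ((incident_face_vertex hm hn).2 (Or.inl ⟨0, Nat.zero_le _, by simp⟩))
    rw [incident_face_vertex hm hn] at h1 h2
    rw [hj, Subsingleton.elim i j]
    rcases h1 with ⟨r, hr, h1⟩ | ⟨r, hr, h1⟩ <;> rcases h2 with ⟨s, hs, h2⟩ | ⟨s, hs, h2⟩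
    · rw [h1, mul_assoc, ← pow_add, left_eq_mul] at h2
      have := (hz (i := (r + s : ℕ)) (j := 0)).1 (by rw [zpow_natCast, h2, zpow_zero])
      have hr0 : r = 0 := by omega
      rw [h1, hr0, pow_zero, mul_one]
    all_goals
      have h3 := congrArg height h1
      have h4 := congrArg height h2
      simp at h3 h4
      omega

/-! ### Rigidity for coprime parameters different from one -/

lemma inThreeFaces_apply (hF : IsCellAut F) {e : CellIndex m n} (h : InThreeFaces e) :
    InThreeFaces (F e) := by
  obtain ⟨c₁, c₂, c₃, h12, h13, h23, d1, d2, d3, i1, i2, i3⟩ := h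
  exact ⟨F c₁, F c₂, F c₃, F.injective.ne h12, F.injective.ne h13, F.injective.ne h23,
    (hF.dim _).trans d1, (hF.dim _).trans d2, (hF.dim _).trans d3,
    (hF.incident _ _).2 i1, (hF.incident _ _).2 i2, (hF.incident _ _).2 i3⟩

lemma symm (hF : IsCellAut F) : IsCellAut F.symm :=
  ⟨fun c => by rw [← hF.dim, Equiv.apply_symm_apply],
    fun c d => by rw [← hF.incident, Equiv.apply_symm_apply, Equiv.apply_symm_apply]⟩

lemma inThreeFaces_apply_iff (hF : IsCellAut F) {e : CellIndex m n} :
    InThreeFaces (F e) ↔ InThreeFaces e :=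
  ⟨fun h => by simpa using hF.symm.inThreeFaces_apply h, hF.inThreeFaces_apply⟩

/-- An edge `t` belongs only to the two faces on its two sides. -/
lemma not_inThreeFaces_t (hm : 1 ≤ m) (hn : 1 ≤ n) (hk : m.gcd n = 1) (g : PiOne m n)
    (i : ZMod (m.gcd n)) : ¬ InThreeFaces (.edge g (.t i)) := by
  have : Subsingleton (ZMod (m.gcd n)) := by rw [hk]; infer_instance
  have key : ∀ c : CellIndex m n, c.dim = 2 → Incident c (.edge g (.t i)) →
      c = .face g i ∨ c = .face (g * (gen m n .a ^ (n / m.gcd n))⁻¹) i := by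
    intro c hc h
    obtain ⟨h', j, rfl⟩ := exists_face_of_dim hc
    rw [Subsingleton.elim i j] at *
    rcases (incident_face_edge_t hm hn).1 h with ⟨rfl, -⟩ | ⟨rfl, -⟩
    · exact Or.inl rfl
    · exact Or.inr (by rw [mul_inv_cancel_right])
  rintro ⟨c₁, c₂, c₃, h12, h13, h23, d1, d2, d3, i1, i2, i3⟩
  rcases key _ d1 i1 with rfl | rfl <;> rcases key _ d2 i2 with rfl | rfl <;>
    rcases key _ d3 i3 with rfl | rfl <;> simp at h12 h13 h23

/-- An edge `a` belongs to `m + n` faces, of which at least three are exhibited here. -/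
lemma inThreeFaces_a (hm : 1 ≤ m) (hn : 1 ≤ n) (hpq : m / m.gcd n ≠ n / m.gcd n)
    (g : PiOne m n) : InThreeFaces (.edge g .a) := by
  have hp := div_gcd_pos_left (n := n) hm
  have hq := div_gcd_pos_right (m := m) hn
  have ha := gen_ne_one hm hn .a
  have hface : ∀ {g h : PiOne m n}, height g ≠ height h →
      (CellIndex.face g 0 : CellIndex m n) ≠ .face h 0 := by
    intro g h hgh he
    exact hgh (by rw [(CellIndex.face.inj he).1])
  by_cases h : 2 ≤ n / m.gcd n
  · refine ⟨.face g 0, .face (g * (gen m n .a)⁻¹) 0, .face (g * (gen m n (.t 0))⁻¹) 0,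
      by simpa using ha, hface (by simp), hface (by simp), rfl, rfl, rfl, ?_, ?_, ?_⟩
    · exact (incident_face_edge_a hm hn).2 (Or.inl ⟨0, hq, by simp⟩)
    · exact (incident_face_edge_a hm hn).2 (Or.inl ⟨1, h, by simp⟩)
    · exact (incident_face_edge_a hm hn).2 (Or.inr ⟨0, hp, by simp⟩)
  · have h' : 1 < m / m.gcd n := by omega
    refine ⟨.face g 0, .face (g * (gen m n .a)⁻¹ * (gen m n (.t 0))⁻¹) 0,
      .face (g * (gen m n (.t 0))⁻¹) 0, hface (by simp), hface (by simp), by simpa using ha,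
      rfl, rfl, rfl, ?_, ?_, ?_⟩
    · exact (incident_face_edge_a hm hn).2 (Or.inl ⟨0, hq, by simp⟩)
    · exact (incident_face_edge_a hm hn).2 (Or.inr ⟨1, h', by simp⟩)
    · exact (incident_face_edge_a hm hn).2 (Or.inr ⟨0, hp, by simp⟩)

/-- If `m` and `n` are coprime and not both one, then a combinatorial automorphism maps all
branching lines to branching lines, either all of them with preservation or all of them with
reversal of the orientation, and it preserves the direction of the edges `t`. -/
lemma exists_orientation (hm : 1 ≤ m) (hn : 1 ≤ n) (hk : m.gcd n = 1)
    (hpq : m / m.gcd n ≠ n / m.gcd n) (hF : IsCellAut F) (hv : Function.Injective v)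
    (hFv : ∀ g, F (.vertex g) = .vertex (v g)) :
    ∃ ε : ℤ, (ε = 1 ∨ ε = -1) ∧
      ∀ g, (∀ j : ℤ, v (g * gen m n .a ^ j) = v g * gen m n .a ^ (ε * j)) ∧
        v (g * gen m n (.t 0)) = v g * gen m n (.t 0) := by
  have hsub : Subsingleton (ZMod (m.gcd n)) := by rw [hk]; infer_instance
  have hz : ∀ {i j : ℤ}, gen m n .a ^ i = gen m n .a ^ j ↔ i = j := a_zpow_inj hm hn
  have hrel := gen_relation (0 : ZMod (m.gcd n))
  rw [Subsingleton.elim (0 + 1 : ZMod (m.gcd n)) 0] at hrel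
  -- The number of faces distinguishes the edges `a` from the edges `t`.
  have hA : ∀ g, ∃ ε : ℤ, (ε = 1 ∨ ε = -1) ∧ v (g * gen m n .a) = v g * gen m n .a ^ ε := by
    intro g
    obtain ⟨h, y, hy, he⟩ := hF.exists_edge hm hn hv hFv g .a
    have h3 := hF.inThreeFaces_apply_iff.2 (inThreeFaces_a hm hn hpq g)
    rw [hy] at h3
    cases y with
    | a =>
      rcases he with ⟨h1, h2⟩ | ⟨h1, h2⟩
      · exact ⟨1, Or.inl rfl, by rw [h2, h1, zpow_one]⟩
      · exact ⟨-1, Or.inr rfl, by rw [h2, h1, zpow_neg_one, mul_inv_cancel_right]⟩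
    | t i => exact absurd h3 (not_inThreeFaces_t hm hn hk h i)
  have hT : ∀ g, v (g * gen m n (.t 0)) = v g * gen m n (.t 0) ∨
      v (g * gen m n (.t 0)) = v g * (gen m n (.t 0))⁻¹ := by
    intro g
    obtain ⟨h, y, hy, he⟩ := hF.exists_edge hm hn hv hFv g (.t 0)
    have h3 := mt hF.inThreeFaces_apply_iff.1 (not_inThreeFaces_t hm hn hk g 0)
    rw [hy] at h3
    cases y with
    | a => exact absurd (inThreeFaces_a hm hn hpq h) h3
    | t i =>
      rw [Subsingleton.elim i 0] at he
      rcases he with ⟨h1, h2⟩ | ⟨h1, h2⟩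
      · exact Or.inl (by rw [h2, h1])
      · exact Or.inr (by rw [h2, h1, mul_inv_cancel_right])
  choose e he1 he2 using hA
  -- The orientation is constant along a branching line, as there is no backtracking.
  have he3 : ∀ g, e (g * gen m n .a) = e g := by
    intro g
    have h1 := he2 (g * gen m n .a)
    rw [he2 g, mul_assoc (v g), ← zpow_add] at h1
    have h2 : e g + e (g * gen m n .a) ≠ 0 := by
      intro h0
      rw [h0, zpow_zero, mul_one] at h1
      have h3 := hv h1
      rw [mul_assoc, mul_eq_left] at h3
      have := (hz (i := 2) (j := 0)).1 (by rw [zpow_ofNat, pow_two, h3, zpow_zero])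
      omega
    rcases he1 g with h | h <;> rcases he1 (g * gen m n .a) with h' | h' <;> omega
  have he4 : ∀ g (j : ℤ), e (g * gen m n .a ^ j) = e g := by
    intro g j
    induction j using Int.induction_on with
    | zero => simp
    | succ j ih => rw [zpow_add_one, ← mul_assoc, he3, ih]
    | pred j ih => rw [← he3, mul_assoc, ← zpow_add_one, sub_add_cancel, ih]
  have hline : ∀ g (j : ℤ), v (g * gen m n .a ^ j) = v g * gen m n .a ^ (e g * j) := by
    intro g j
    rw [zpow_mul]
    exact map_zpow_of_map_mul (fun j => by rw [he2, he4]) j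
  -- If an edge `t` were reversed, then the lower and the upper path of a face would be exchanged,
  -- and they would have the same length.
  have hT' : ∀ g, v (g * gen m n (.t 0)) = v g * gen m n (.t 0) := by
    intro g
    rcases hT g with h | h
    · exact h
    exfalso
    obtain ⟨c, i, hc⟩ := exists_face_of_dim (hF.dim (.face g 0))
    have hinc : ∀ w, Incident (.face g 0) (.vertex w) → Incident (.face c i) (.vertex (v w)) := by
      intro w hw
      rwa [← hc, ← hFv, hF.incident]
    have h1 := hinc (g * gen m n .a ^ 0)
      ((incident_face_vertex hm hn).2 (Or.inl ⟨0, Nat.zero_le _, rfl⟩))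
    have h2 := hinc _ ((incident_face_vertex hm hn).2 (Or.inl ⟨_, le_rfl, rfl⟩))
    have h3 := hinc (g * gen m n (.t 0) * gen m n .a ^ 0)
      ((incident_face_vertex hm hn).2 (Or.inr ⟨0, Nat.zero_le _, rfl⟩))
    have h4 := hinc _ ((incident_face_vertex hm hn).2 (Or.inr ⟨_, le_rfl, rfl⟩))
    simp only [← zpow_natCast] at h1 h2 h3 h4
    rw [hline, incident_face_vertex hm hn] at h1 h2 h3 h4
    rw [h] at h3 h4
    have key : ∀ (w : PiOne m n) (ε : ℤ) (r s N N' : ℕ), (ε = 1 ∨ ε = -1) → r ≤ N → s ≤ N →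
        w = c * gen m n .a ^ r → w * gen m n .a ^ (ε * N') = c * gen m n .a ^ s → N' ≤ N := by
      rintro w ε r s N N' hε hr hs rfl hw
      rw [mul_assoc, mul_left_cancel_iff, ← zpow_natCast, ← zpow_natCast, ← zpow_add, hz] at hw
      rcases hε with rfl | rfl <;> omega
    have key' : ∀ (w : PiOne m n) (ε : ℤ) (r s N N' : ℕ), (ε = 1 ∨ ε = -1) → r ≤ N → s ≤ N →
        w = c * gen m n (.t i) * gen m n .a ^ r →
        w * gen m n .a ^ (ε * N') = c * gen m n (.t i) * gen m n .a ^ s → N' ≤ N := by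
      rintro w ε r s N N' hε hr hs rfl hw
      rw [mul_assoc, mul_left_cancel_iff, ← zpow_natCast, ← zpow_natCast, ← zpow_add, hz] at hw
      rcases hε with rfl | rfl <;> omega
    simp only [Nat.cast_zero, mul_zero, zpow_zero, mul_one] at h1 h3
    have hh : height (v g) = height c + 1 := by
      have e1 : height (v g) = height c ∨ height (v g) = height c + 1 := by
        rcases h1 with ⟨r, -, h1⟩ | ⟨r, -, h1⟩ <;> rw [h1] <;> simp
      have e3 : height (v g) - 1 = height c ∨ height (v g) - 1 = height c + 1 := by
        have e4 : height (v g) - 1 = height (v g * (gen m n (.t 0))⁻¹) := by simp; ring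
        rw [e4]
        rcases h3 with ⟨r, -, h3⟩ | ⟨r, -, h3⟩ <;> rw [h3] <;> simp
      omega
    rcases h1 with ⟨r, hr, h1⟩ | ⟨r, hr, h1⟩
    · have := congrArg height h1; simp at this; omega
    rcases h2 with ⟨s, hs, h2⟩ | ⟨s, hs, h2⟩
    · have := congrArg height h2; simp at this; omega
    rcases h3 with ⟨r', hr', h3⟩ | ⟨r', hr', h3⟩
    swap
    · have := congrArg height h3; simp at this; omega
    rcases h4 with ⟨s', hs', h4⟩ | ⟨s', hs', h4⟩
    swap
    · have := congrArg height h4; simp at this; omega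
    have l1 := key' _ _ _ _ _ _ (he1 g) hr hs h1 h2
    have l2 := key _ _ _ _ _ _ (he1 _) hr' hs' h3 h4
    exact hpq (le_antisymm l2 l1)
  -- The relation `t a^m = a^n t` carries the orientation over to the next branching line.
  have he5 : ∀ g, e (g * gen m n (.t 0)) = e g := by
    intro g
    have h1 := hT' (g * gen m n .a ^ (n / m.gcd n))
    have h2 := hline (g * gen m n (.t 0)) (m / m.gcd n : ℕ)
    have h3 := hline g (n / m.gcd n : ℕ)
    rw [zpow_natCast] at h2 h3
    rw [mul_assoc g, ← hrel, ← mul_assoc, h2, h3, hT', mul_assoc, mul_assoc,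
      mul_left_cancel_iff] at h1
    have hrel' : ∀ ε : ℤ, (ε = 1 ∨ ε = -1) → gen m n .a ^ (ε * (n / m.gcd n : ℕ)) * gen m n (.t 0) =
        gen m n (.t 0) * gen m n .a ^ (ε * (m / m.gcd n : ℕ)) := by
      rintro ε (rfl | rfl)
      · rw [one_mul, one_mul, zpow_natCast, zpow_natCast, hrel]
      · rw [neg_one_mul, neg_one_mul, zpow_neg, zpow_neg, zpow_natCast, zpow_natCast,
          inv_mul_eq_iff_eq_mul, ← mul_assoc, eq_mul_inv_iff_mul_eq, hrel]
    rw [hrel' _ (he1 g), mul_left_cancel_iff, hz] at h1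
    have hp := div_gcd_pos_left (n := n) hm
    exact mul_right_cancel₀ (by exact_mod_cast hp.ne') h1
  have he6 : ∀ g x, e (g * gen m n x) = e g := by
    intro g x
    cases x with
    | a => exact he3 g
    | t i => rw [Subsingleton.elim i 0]; exact he5 g
  have he7 : ∀ g, e g = e 1 := by
    intro g
    induction g using gen_induction with
    | one => rfl
    | mul_gen g x ih => rw [he6, ih]
    | mul_inv_gen g x ih => rw [← he6, inv_mul_cancel_right, ih]
  exact ⟨e 1, he1 1, fun g => ⟨fun j => by rw [hline, he7], hT' g⟩⟩

/-! ### Rigidity of the square grid -/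

/-- For `m = n = 1` the complex is the square grid: an automorphism that fixes a vertex and two
neighbours of it, one in each direction, fixes every vertex, as two neighbours of a vertex are
opposite if and only if they have no other common neighbour. -/
lemma vertexMap_eq_self_of_grid (hm : 1 ≤ m) (hn : 1 ≤ n) (hk : m.gcd n = 1)
    (hp : m / m.gcd n = 1) (hq : n / m.gcd n = 1) (hF : IsCellAut F) (hv : Function.Bijective v)
    (hFv : ∀ g, F (.vertex g) = .vertex (v g)) (h0 : v 1 = 1)
    (ha : v (gen m n .a) = gen m n .a) (ht : v (gen m n (.t 0)) = gen m n (.t 0))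
    (g : PiOne m n) : v g = g := by
  have hsub : Subsingleton (ZMod (m.gcd n)) := by rw [hk]; infer_instance
  have hcomm : Commute (gen m n .a) (gen m n (.t 0)) := by
    have h := gen_relation (0 : ZMod (m.gcd n))
    rw [hp, hq, pow_one, Subsingleton.elim (0 + 1 : ZMod (m.gcd n)) 0] at h
    exact h.symm
  let P : PiOne m n → ℤ → ℤ → PiOne m n := fun g i j => g * (gen m n .a ^ i * gen m n (.t 0) ^ j)
  have hPP : ∀ g i j i' j', P (P g i j) i' j' = P g (i + i') (j + j') := by
    intro g i j i' j'
    simp only [P]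
    rw [zpow_add, zpow_add, mul_assoc, mul_assoc, mul_assoc,
      ← mul_assoc (gen m n (.t 0) ^ j), (hcomm.zpow_zpow i' j).symm.eq, mul_assoc]
  have hP0 : ∀ g, P g 0 0 = g := fun g => by simp [P]
  have hPinj : ∀ {g i j i' j'}, P g i j = P g i' j' → i = i' ∧ j = j' := by
    intro g i j i' j' h
    simp only [P, mul_left_cancel_iff] at h
    have h1 : j = j' := by simpa using congrArg height h
    subst h1
    exact ⟨(a_zpow_inj hm hn).1 (mul_right_cancel h), rfl⟩
  let U : ℤ → ℤ → Prop := fun i j =>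
    (i = 1 ∧ j = 0) ∨ (i = -1 ∧ j = 0) ∨ (i = 0 ∧ j = 1) ∨ (i = 0 ∧ j = -1)
  have hPa : ∀ g, P g 1 0 = g * gen m n .a := fun g => by simp [P]
  have hPt : ∀ g i, P g 0 1 = g * gen m n (.t i) := fun g i => by
    rw [Subsingleton.elim i 0]; simp [P]
  have hPa' : ∀ g, P g (-1) 0 = g * (gen m n .a)⁻¹ := fun g => by simp [P]
  have hPt' : ∀ g i, P g 0 (-1) = g * (gen m n (.t i))⁻¹ := fun g i => by
    rw [Subsingleton.elim i 0]; simp [P]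
  -- Adjacency of vertices, in coordinates.
  have hgen : ∀ x, ∃ i j, U i j ∧ U (-i) (-j) ∧ ∀ g, g * gen m n x = P g i j := by
    intro x
    cases x with
    | a => exact ⟨1, 0, by simp [U], by simp [U], fun g => (hPa g).symm⟩
    | t i => exact ⟨0, 1, by simp [U], by simp [U], fun g => (hPt g i).symm⟩
  have hgen' : ∀ g i j, U i j → ∃ h x, Incident (.edge h x) (.vertex g) ∧
      Incident (.edge h x) (.vertex (P g i j)) := by
    rintro g i j (⟨rfl, rfl⟩ | ⟨rfl, rfl⟩ | ⟨rfl, rfl⟩ | ⟨rfl, rfl⟩)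
    · exact ⟨g, .a, incident_edge_vertex.2 (by simp), incident_edge_vertex.2 (by simp [hPa])⟩
    · exact ⟨g * (gen m n .a)⁻¹, .a, incident_edge_vertex.2 (by simp),
        incident_edge_vertex.2 (by simp [hPa'])⟩
    · exact ⟨g, .t 0, incident_edge_vertex.2 (by simp), incident_edge_vertex.2 (by simp [hPt _ 0])⟩
    · exact ⟨g * (gen m n (.t 0))⁻¹, .t 0, incident_edge_vertex.2 (by simp),
        incident_edge_vertex.2 (by simp [hPt' _ 0])⟩
  have hadj : ∀ {g w : PiOne m n}, g ≠ w → (∃ h x, Incident (.edge h x) (.vertex g) ∧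
      Incident (.edge h x) (.vertex w)) → ∃ i j, U i j ∧ w = P g i j := by
    rintro g w hgw ⟨h, x, h1, h2⟩
    obtain ⟨i, j, hU, hU', hx⟩ := hgen x
    rw [incident_edge_vertex, hx] at h1 h2
    rcases h1 with rfl | rfl <;> rcases h2 with rfl | rfl
    · exact absurd rfl hgw
    · exact ⟨i, j, hU, rfl⟩
    · exact ⟨-i, -j, hU', by rw [hPP, add_neg_cancel, add_neg_cancel, hP0]⟩
    · exact absurd rfl hgw
  have hUne : ∀ {g i j}, U i j → g ≠ P g i j := by
    intro g i j hU h
    obtain ⟨rfl, rfl⟩ := hPinj ((hP0 g).trans h)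
    simp [U] at hU
  have hmap : ∀ {g i j}, U i j → ∃ i' j', U i' j' ∧ v (P g i j) = P (v g) i' j' := by
    intro g i j hU
    obtain ⟨h, x, h1, h2⟩ := hgen' g i j hU
    refine hadj (hv.1.ne (hUne hU)) ?_
    obtain ⟨h', y, hy, -⟩ := hF.exists_edge hm hn hv.1 hFv h x
    exact ⟨h', y, by rwa [← hy, ← hFv, hF.incident], by rwa [← hy, ← hFv, hF.incident]⟩
  have hmap' : ∀ {g i j}, U i j → ∃ w i' j', U i' j' ∧ w = P g i' j' ∧ v w = P (v g) i j := by
    intro g i j hU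
    obtain ⟨h, x, h1, h2⟩ := hgen' (v g) i j hU
    obtain ⟨w, hw⟩ := hv.2 (P (v g) i j)
    have hne : g ≠ w := fun h => hUne hU (by rw [← hw, h])
    obtain ⟨c, hc⟩ := F.surjective (.edge h x)
    obtain ⟨h', y, rfl⟩ := exists_edge_of_dim (c := c) (by rw [← hF.dim, hc]; rfl)
    obtain ⟨i', j', hU', hw'⟩ := hadj hne
      ⟨h', y, by rwa [← hF.incident, hc, hFv], by rwa [← hF.incident, hc, hFv, hw]⟩
    exact ⟨w, i', j', hU', hw', hw⟩
  -- Opposite neighbours of a fixed vertex are fixed together.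
  have hopp : ∀ {g i j}, U i j → v g = g → v (P g i j) = P g i j →
      v (P g (-i) (-j)) = P g (-i) (-j) := by
    intro g i j hU hg hgb
    have hU' : U (-i) (-j) := by simp only [U] at hU ⊢; omega
    obtain ⟨r, s, hrs, hc⟩ := hmap (g := g) hU'
    rw [hg] at hc
    by_cases hbr : r = -i ∧ s = -j
    · rw [hc, hbr.1, hbr.2]
    exfalso
    by_cases hbs : r = i ∧ s = j
    · rw [hbs.1, hbs.2, ← hgb] at hc
      obtain ⟨h1, h2⟩ := hPinj (hv.1 hc)
      simp only [U] at hU; omega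
    obtain ⟨w, i₁, j₁, hU1, hw1, hvw⟩ := hmap' (g := P g i j) hrs
    obtain ⟨w', i₂, j₂, hU2, hw2, hvw'⟩ := hmap' (g := P g (-i) (-j)) hU
    have hww : w = w' := hv.1 (by
      rw [hvw, hvw', hgb, hc, hPP, hPP, add_comm i r, add_comm j s])
    subst hww
    rw [hw1, hPP, hPP] at hw2
    obtain ⟨e1, e2⟩ := hPinj hw2
    have e3 : i + i₁ = 0 ∧ j + j₁ = 0 := by simp only [U] at hU hU1 hU2; omega
    rw [hw1, hPP, e3.1, e3.2, hP0, hgb, hPP, hg] at hvw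
    obtain ⟨e4, e5⟩ := hPinj ((hP0 g).trans hvw)
    exact hbr ⟨by omega, by omega⟩
  -- The fourth vertex of a square is fixed if the three others are.
  have hsq : ∀ {g}, v g = g → v (P g 1 0) = P g 1 0 → v (P g 0 1) = P g 0 1 →
      v (P g 1 1) = P g 1 1 := by
    intro g hg hga hgt
    obtain ⟨i, j, hU, h1⟩ := hmap (g := P g 1 0) (i := 0) (j := 1) (by simp [U])
    obtain ⟨i', j', hU', h2⟩ := hmap (g := P g 0 1) (i := 1) (j := 0) (by simp [U])
    rw [hga, hPP, hPP] at h1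
    rw [hgt, hPP, hPP] at h2
    simp only [add_zero, zero_add] at h1 h2
    rw [h1] at h2
    obtain ⟨e1, e2⟩ := hPinj h2
    by_cases hi : 1 + i = 0 ∧ j = 0
    · rw [hi.1, hi.2, hP0] at h1
      obtain ⟨e3, -⟩ := hPinj ((hv.1 (h1.trans hg.symm)).trans (hP0 g).symm)
      omega
    · rw [h1]
      have : i = 0 ∧ j = 1 := by simp only [U] at hU hU'; omega
      rw [this.1, this.2, add_zero]
  let Q : PiOne m n → Prop := fun g => v g = g ∧ v (P g 1 0) = P g 1 0 ∧ v (P g 0 1) = P g 0 1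
  suffices hQ : Q g from hQ.1
  have hopp' : ∀ {g h i j i' j'}, h = P g i j → U i j → i' = -i → j' = -j → v g = g → v h = h →
      v (P g i' j') = P g i' j' := by
    rintro g h i j _ _ rfl hU rfl rfl hg hh
    exact hopp hU hg hh
  induction g using gen_induction with
  | one => exact ⟨h0, by simpa [P] using ha, by simpa [P] using ht⟩
  | mul_gen g x ih =>
    obtain ⟨h1, h2, h3⟩ := ih
    have h4 := hsq h1 h2 h3
    cases x with
    | a =>
      rw [← hPa]
      refine ⟨h2, hopp' (i := -1) (j := 0) (h := g) ?_ (by simp [U]) rfl rfl h2 h1, ?_⟩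
      · rw [hPP]; simp [hP0]
      · rw [hPP]; exact h4
    | t i =>
      rw [← hPt]
      refine ⟨h3, ?_, hopp' (i := 0) (j := -1) (h := g) ?_ (by simp [U]) rfl rfl h3 h1⟩
      · rw [hPP]; exact h4
      · rw [hPP]; simp [hP0]
  | mul_inv_gen g x ih =>
    obtain ⟨h1, h2, h3⟩ := ih
    have h4 := hsq h1 h2 h3
    cases x with
    | a =>
      have h5 := hopp (i := 1) (j := 0) (by simp [U]) h1 h2
      have h6 := hopp' (g := P g 0 1) (i := 1) (j := 0) (h := P g 1 1) (by rw [hPP]; rfl)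
        (by simp [U]) rfl rfl h3 h4
      rw [← hPa']
      refine ⟨h5, ?_, ?_⟩
      · rw [hPP]; simpa [hP0] using h1
      · rw [hPP] at h6 ⊢; exact h6
    | t i =>
      have h5 := hopp (i := 0) (j := 1) (by simp [U]) h1 h3
      have h6 := hopp' (g := P g 1 0) (i := 0) (j := 1) (h := P g 1 1) (by rw [hPP]; rfl)
        (by simp [U]) rfl rfl h2 h4
      rw [← hPt' g i]
      refine ⟨h5, ?_, ?_⟩
      · rw [hPP] at h6 ⊢; exact h6
      · rw [hPP]; simpa [hP0] using h1

end IsCellAut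

/-! ### Discreteness if the greatest common divisor is one -/

lemma eq_one_of_fixes_vertices (hm : 1 ≤ m) (hn : 1 ≤ n) (hk : m.gcd n = 1) {f : AutX m n}
    (h : ∀ g, indexPerm hm hn f (.vertex g) = .vertex g) : f = 1 :=
  indexPerm_injective hm hn (by
    rw [map_one]; exact (isCellAut_indexPerm hm hn f).eq_one_of_vertices hm hn hk h)

lemma eq_one_of_fixes_three_vertices (hm : 1 ≤ m) (hn : 1 ≤ n) (hk : m.gcd n = 1) {f : AutX m n}
    (h1 : indexPerm hm hn f (.vertex 1) = .vertex 1)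
    (ha : indexPerm hm hn f (.vertex (gen m n .a)) = .vertex (gen m n .a))
    (ht : indexPerm hm hn f (.vertex (gen m n (.t 0))) = .vertex (gen m n (.t 0))) : f = 1 := by
  have hF := isCellAut_indexPerm hm hn f
  obtain ⟨v, hv, hFv⟩ := hF.exists_vertexMap
  rw [hFv, CellIndex.vertex.injEq] at h1 ha ht
  refine eq_one_of_fixes_vertices hm hn hk fun g => ?_
  rw [hFv, CellIndex.vertex.injEq]
  by_cases hpq : m / m.gcd n = n / m.gcd n
  · have hgcd := Nat.gcd_div_gcd_div_gcd_of_pos_left (m := n) hm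
    have hp : m / m.gcd n = 1 := by rwa [← hpq, Nat.gcd_self] at hgcd
    exact hF.vertexMap_eq_self_of_grid hm hn hk hp (hpq.symm.trans hp) hv hFv h1 ha ht g
  · have hsub : Subsingleton (ZMod (m.gcd n)) := by rw [hk]; infer_instance
    obtain ⟨ε, hε, h⟩ := hF.exists_orientation hm hn hk hpq hv.1 hFv
    have hε1 : ε = 1 := by
      have h2 := (h 1).1 1
      rw [zpow_one, one_mul, ha, h1, one_mul, mul_one] at h2
      exact ((a_zpow_inj hm hn (i := 1)).1 (by rw [zpow_one]; exact h2)).symm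
    rw [eq_mul_of_map_mul_gen (v := v) (fun g x => ?_) g, h1, one_mul]
    cases x with
    | a => simpa [hε1] using (h g).1 1
    | t i => rw [Subsingleton.elim i 0]; exact (h g).2

lemma discreteTopology (hm : 1 ≤ m) (hn : 1 ≤ n) (hk : m.gcd n = 1) :
    DiscreteTopology (AutX m n) := by
  rw [discreteTopology_iff_isOpen_singleton]
  intro f
  have hopen : ∀ w : PiOne m n, IsOpen {f' : AutX m n | cellPerm (openCells m n) f' (vertexCell w) =
      cellPerm (openCells m n) f (vertexCell w)} := fun w =>
    TopologicalSpace.isOpen_generateFrom_of_mem ⟨_, _, rfl⟩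
  convert ((hopen 1).inter (hopen (gen m n .a))).inter (hopen (gen m n (.t 0))) using 1
  ext f'
  constructor
  · rintro rfl
    exact ⟨⟨rfl, rfl⟩, rfl⟩
  · rintro ⟨⟨h1, ha⟩, ht⟩
    have key : ∀ w : PiOne m n, cellPerm (openCells m n) f' (vertexCell w) =
        cellPerm (openCells m n) f (vertexCell w) →
        indexPerm hm hn (f⁻¹ * f') (.vertex w) = .vertex w := by
      intro w hw
      rw [← cellPerm_vertexCell_iff, map_mul, map_inv, Equiv.Perm.mul_apply, hw,
        ← Equiv.Perm.mul_apply, inv_mul_cancel, Equiv.Perm.one_apply]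
    exact (inv_mul_eq_one.1 (eq_one_of_fixes_three_vertices hm hn hk (key _ h1) (key _ ha)
      (key _ ht))).symm

/-! ### The orientation character -/

/-- An automorphism has orientation `ε` if it maps every branching line onto a branching line, with
preservation of the orientation for `ε = 1`, and with reversal for `ε = -1`. -/
def HasOrientation (ε : ℤˣ) (f : AutX m n) : Prop :=
  ∀ g : PiOne m n, ∃ h : PiOne m n, ∀ j : ℤ,
    cellPerm _ f (vertexCell (g * gen m n .a ^ j)) = vertexCell (h * gen m n .a ^ ((ε : ℤ) * j))

lemma hasOrientation_one {f : AutX m n} : HasOrientation 1 f ↔ OrientationPreserving f := by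
  simp [HasOrientation, OrientationPreserving]

lemma hasOrientation_neg_one {f : AutX m n} : HasOrientation (-1) f ↔ OrientationReversing f := by
  simp [HasOrientation, OrientationReversing]

lemma HasOrientation.mul {ε δ : ℤˣ} {f g : AutX m n} (hf : HasOrientation ε f)
    (hg : HasOrientation δ g) : HasOrientation (ε * δ) (f * g) := by
  intro w
  obtain ⟨w', hw'⟩ := hg w
  obtain ⟨w'', hw''⟩ := hf w'
  refine ⟨w'', fun j => ?_⟩
  rw [map_mul, Equiv.Perm.mul_apply, hw', hw'', Units.val_mul, mul_assoc]

lemma HasOrientation.unique (hm : 1 ≤ m) (hn : 1 ≤ n) {ε δ : ℤˣ} {f : AutX m n}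
    (h : HasOrientation ε f) (h' : HasOrientation δ f) : ε = δ := by
  obtain ⟨w, hw⟩ := h 1
  obtain ⟨w', hw'⟩ := h' 1
  have key : ∀ j : ℤ, w * gen m n .a ^ ((ε : ℤ) * j) = w' * gen m n .a ^ ((δ : ℤ) * j) := fun j =>
    CellIndex.vertex.inj ((cellEquiv hm hn).injective ((hw j).symm.trans (hw' j)))
  have h0 := key 0
  have h1 := key 1
  simp only [mul_zero, zpow_zero, mul_one] at h0 h1
  rw [h0, mul_left_cancel_iff, a_zpow_inj hm hn] at h1
  exact Units.ext h1

/-- If `m` and `n` are coprime and not both one, then every automorphism has an orientation `ε`: it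
maps the end `g a` of an edge to `v g a ^ ε` and the end `g t` to `v g t`, where `v` is its effect
on the vertices. -/
lemma exists_hasOrientation (hm : 1 ≤ m) (hn : 1 ≤ n) (hk : m.gcd n = 1)
    (hpq : m / m.gcd n ≠ n / m.gcd n) (f : AutX m n) : ∃ ε : ℤˣ, HasOrientation ε f ∧
      ∃ v : PiOne m n → PiOne m n, (∀ g, indexPerm hm hn f (.vertex g) = .vertex (v g)) ∧
        ∀ g, v (g * gen m n .a) = v g * gen m n .a ^ (ε : ℤ) ∧
          v (g * gen m n (.t 0)) = v g * gen m n (.t 0) := by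
  have hF := isCellAut_indexPerm hm hn f
  obtain ⟨v, hv, hFv⟩ := hF.exists_vertexMap
  obtain ⟨ε, hε, h⟩ := hF.exists_orientation hm hn hk hpq hv.1 hFv
  obtain ⟨ε, rfl⟩ : ∃ ε' : ℤˣ, (ε' : ℤ) = ε := by
    rcases hε with rfl | rfl
    · exact ⟨1, rfl⟩
    · exact ⟨-1, rfl⟩
  refine ⟨ε, fun g => ⟨v g, fun j => ?_⟩, v, hFv, fun g => ⟨by simpa using (h g).1 1, (h g).2⟩⟩
  rw [cellPerm_vertexCell_iff hm hn, hFv, (h g).1]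

lemma hasOrientation_deck (hm : 1 ≤ m) (hn : 1 ≤ n) (d : PiOne m n) :
    HasOrientation 1 (deck hm hn d) := by
  refine fun g => ⟨d * g, fun j => ?_⟩
  rw [cellPerm_vertexCell_iff hm hn, indexPerm_deck_vertex, Units.val_one, one_mul, mul_assoc]

/-- If the greatest common divisor is one, then the orientation preserving automorphisms are the
deck transformations. -/
lemma exists_deck_eq (hm : 1 ≤ m) (hn : 1 ≤ n) (hk : m.gcd n = 1)
    (hpq : m / m.gcd n ≠ n / m.gcd n) {f : AutX m n} (hf : HasOrientation 1 f) :
    ∃ d, deck hm hn d = f := by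
  have hsub : Subsingleton (ZMod (m.gcd n)) := by rw [hk]; infer_instance
  obtain ⟨ε, hε, v, hFv, hv⟩ := exists_hasOrientation hm hn hk hpq f
  obtain rfl := hε.unique hm hn hf
  refine ⟨v 1, inv_mul_eq_one.1 (eq_one_of_fixes_vertices hm hn hk fun g => ?_)⟩
  rw [map_mul, map_inv, Equiv.Perm.mul_apply, Equiv.Perm.inv_eq_iff_eq, hFv,
    indexPerm_deck_vertex, eq_mul_of_map_mul_gen (v := v) (fun g x => ?_) g]
  cases x with
  | a => simpa using (hv g).1
  | t i => rw [Subsingleton.elim i 0]; exact (hv g).2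

lemma exists_hasOrientation_neg_one (hm : 1 ≤ m) (hn : 1 ≤ n) :
    ∃ f : AutX m n, HasOrientation (-1) f := by
  obtain ⟨f, hf⟩ := exists_reflection (m := m) (n := n) hm hn
  refine ⟨f, fun g => ⟨reflectHom m n g, fun j => ?_⟩⟩
  rw [cellPerm_vertexCell_iff hm hn, hf, map_mul, map_zpow, reflectHom_a, inv_zpow', Units.val_neg,
    Units.val_one, neg_one_mul]

/-- If `m` and `n` are coprime, then the fundamental group of `Z_{m,n}` is `BS(m,n)`. -/
lemma exists_mulEquiv_piOne (hk : m.gcd n = 1) : ∃ φ : BS m n ≃* PiOne m n,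
    φ (PresentedGroup.of BSGen.a) = gen m n .a ∧
      φ (PresentedGroup.of BSGen.t) = gen m n (.t 0) := by
  have hsub : Subsingleton (ZMod (m.gcd n)) := by rw [hk]; infer_instance
  have hp : m / m.gcd n = m := by rw [hk, Nat.div_one]
  have hq : n / m.gcd n = n := by rw [hk, Nat.div_one]
  let f : BSGen → PiOne m n := fun x => match x with
    | .a => gen m n .a
    | .t => gen m n (.t 0)
  let φ : BS m n →* PiOne m n := PresentedGroup.toGroup (f := f) (by
    rintro _ rfl
    simp only [map_mul, map_pow, map_inv, FreeGroup.lift_apply_of, f]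
    have h := gen_relation (0 : ZMod (m.gcd n))
    rw [hp, hq, Subsingleton.elim (0 + 1 : ZMod (m.gcd n)) 0] at h
    rw [mul_inv_eq_one, mul_inv_eq_iff_eq_mul, h])
  let a : BS m n := PresentedGroup.of BSGen.a
  let t : BS m n := PresentedGroup.of BSGen.t
  have hrel : t * a ^ m = a ^ n * t := by
    have h : PresentedGroup.mk ({FreeGroup.of BSGen.t * FreeGroup.of BSGen.a ^ m *
        (FreeGroup.of BSGen.t)⁻¹ * (FreeGroup.of BSGen.a ^ n)⁻¹} : Set (FreeGroup BSGen)) _ = 1 :=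
      PresentedGroup.one_of_mem rfl
    simp only [map_mul, map_pow, map_inv] at h
    rw [mul_inv_eq_one, mul_inv_eq_iff_eq_mul] at h
    exact h
  let f' : Gen (m.gcd n) → BS m n := fun x => match x with
    | .a => a
    | .t _ => t
  let ψ : PiOne m n →* BS m n := PresentedGroup.toGroup (f := f') (by
    rintro _ ⟨i, rfl⟩
    simp only [boundaryWord, map_mul, map_pow, map_inv, FreeGroup.lift_apply_of, f']
    rw [mul_inv_eq_one, mul_inv_eq_iff_eq_mul, hp, hq, hrel])
  have hφa : φ a = gen m n .a := PresentedGroup.toGroup.of _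
  have hφt : φ t = gen m n (.t 0) := PresentedGroup.toGroup.of _
  have hψa : ψ (gen m n .a) = a := PresentedGroup.toGroup.of _
  have hψt : ∀ i, ψ (gen m n (.t i)) = t := fun i => PresentedGroup.toGroup.of _
  refine ⟨MonoidHom.toMulEquiv φ ψ (PresentedGroup.ext fun x => ?_)
    (PresentedGroup.ext fun x => ?_), hφa, hφt⟩
  · cases x with
    | a => exact (congrArg ψ hφa).trans hψa
    | t => exact (congrArg ψ hφt).trans (hψt 0)
  · cases x with
    | a => exact (congrArg φ hψa).trans hφa
    | t i =>
      rw [Subsingleton.elim i 0]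
      exact (congrArg φ (hψt 0)).trans hφt

end BaumslagSolitar

open BaumslagSolitar CellStructure in
theorem mainTheorem4 (m n : ℕ) (hm : 1 ≤ m) (hn : 1 ≤ n) :
    (DiscreteTopology (AutX m n) ↔ m.gcd n = 1) ∧
    (m.gcd n = 1 → ¬ (m = 1 ∧ n = 1) →
      ∃ χ : AutX m n →* ℤˣ,
        (∀ f, χ f = 1 ↔ OrientationPreserving f) ∧
        (∀ f, χ f = -1 ↔ OrientationReversing f) ∧
        ∃ ι : BS m n →* AutX m n,
          (∀ g : PiOne m n,
            cellPerm _ (ι (PresentedGroup.of BSGen.a)) (vertexCell g) =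
              vertexCell (gen m n .a * g) ∧
            cellPerm _ (ι (PresentedGroup.of BSGen.t)) (vertexCell g) =
              vertexCell (gen m n (.t 0) * g)) ∧
          Function.Injective ι ∧ ι.range = χ.ker ∧ Function.Surjective χ) := by
  refine ⟨⟨fun h => by_contra fun hk => not_discreteTopology hm hn hk h, discreteTopology hm hn⟩,
    fun hk hmn => ?_⟩
  have hpq : m / m.gcd n ≠ n / m.gcd n := by
    intro h
    rw [hk, Nat.div_one, Nat.div_one] at h
    subst h
    rw [Nat.gcd_self] at hk
    exact hmn ⟨hk, hk⟩
  choose o ho using fun f => (exists_hasOrientation hm hn hk hpq f).imp fun _ => And.left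
  have ho' : ∀ f ε, o f = ε ↔ HasOrientation ε f := fun f ε =>
    ⟨fun h => h ▸ ho f, fun h => (ho f).unique hm hn h⟩
  let χ : AutX m n →* ℤˣ := MonoidHom.mk' o fun f g => (ho' _ _).2 ((ho f).mul (ho g))
  have hχ : ∀ f ε, χ f = ε ↔ HasOrientation ε f := ho'
  obtain ⟨φ, hφa, hφt⟩ := exists_mulEquiv_piOne hk
  refine ⟨χ, fun f => (hχ f 1).trans hasOrientation_one,
    fun f => (hχ f (-1)).trans hasOrientation_neg_one,
    (deck hm hn).comp φ.toMonoidHom, fun g => ⟨?_, ?_⟩, ?_, ?_, fun ε => ?_⟩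
  · rw [cellPerm_vertexCell_iff hm hn, ← hφa]
    exact indexPerm_deck_vertex hm hn _ g
  · rw [cellPerm_vertexCell_iff hm hn, ← hφt]
    exact indexPerm_deck_vertex hm hn _ g
  · refine Function.Injective.comp (g := deck hm hn) (fun d e h => ?_) φ.injective
    have h1 := indexPerm_deck_vertex hm hn d 1
    rw [h, indexPerm_deck_vertex, CellIndex.vertex.injEq, mul_one, mul_one] at h1
    exact h1.symm
  · ext f
    rw [MonoidHom.mem_ker, hχ]
    constructor
    · rintro ⟨b, rfl⟩
      exact hasOrientation_deck hm hn _
    · intro h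
      obtain ⟨d, rfl⟩ := exists_deck_eq hm hn hk hpq h
      exact ⟨φ.symm d, congrArg (deck hm hn) (φ.apply_symm_apply d)⟩
  · rcases Int.units_eq_one_or ε with rfl | rfl
    · exact ⟨1, map_one χ⟩
    · obtain ⟨f, hf⟩ := exists_hasOrientation_neg_one (m := m) (n := n) hm hn
      exact ⟨f, (hχ _ _).2 hf⟩
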